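/- **Setting.** Let $d\in\{2,3\}$, let $\Omega\subset\mathbb R^d$ be a bounded polygonal/polyhedral domain and $\Gamma_D\subset\partial\Omega$. Let $\mathcal T_h$ be a polytopic mesh of $\Omega$ into finitely many polygons/polyhedra $\kappa$ with diameters $h_\kappa$; its faces $F$ are segments ($d=2$) or triangles ($d=3$), split into internal faces $\mathcal F^i$ and boundary faces, each boundary face lying either in $\Gamma_D$ (these form $\mathcal F^D$) or in $\partial\Omega\setminus\Gamma_D$, up to sets of zero surface measure. The mesh is *polytopic-regular with constant* $C_{\rm reg}$: each $\kappa$ contains non-overlapping $d$-simplices $S_\kappa^F$, one for every face $F\subset\partial\kappa$, such that $F$ is a face of $S_\kappa^F$ and $h_\kappa\le C_{\rm reg}\,d\,|S_\kappa^F|/|F|$. Let $p_\kappa\ge1$ be polynomial degrees and $\boldsymbol V_h$ the space of vector fields that are polynomial of total degree $\le p_\kappa$ on each $\kappa$. On each element let constants $\rho_f,\rho_s,\eta,k,m,\lambda,\mu>0$, $0<\phi<1$, $a>1$, $0<\beta\le1$ be given (so $\rho_u^{-1}$ and $k/\eta$ below are in $L^\infty(\Omega)$), and set $\rho=\phi\rho_f+(1-\phi)\rho_s$,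 $\rho_w=a\phi^{-1}\rho_f$, $\rho_u=\tfrac12\rho_s(1-\phi)$, $\mathbb D\boldsymbol e=\lambda\,{\rm tr}(\boldsymbol e)\boldsymbol I+2\mu\boldsymbol e$, $\boldsymbol\sigma(\boldsymbol v)=\mathbb D\boldsymbol\epsilon(\boldsymbol v)$, where $\boldsymbol\epsilon$ is the symmetric gradient; $\overline{\mathbb D}_\kappa=|(\mathbb D|_\kappa)^{1/2}|^2$ is the squared operator norm on symmetric tensors. Let $[\![\boldsymbol v]\!]=\boldsymbol v^+\otimes\boldsymbol n^++\boldsymbol v^-\otimes\boldsymbol n^-$, $[\![\boldsymbol v]\!]_{\boldsymbol n}=\boldsymbol v^+\cdot\boldsymbol n^++\boldsymbol v^-\cdot\boldsymbol n^-$ and let $\{\!\{\cdot\}\!\}$ be the arithmetic mean of the two traces on internal faces; on boundary faces $[\![\boldsymbol v]\!]=\boldsymbol v\otimes\boldsymbol n$, $[\![\boldsymbol v]\!]_{\boldsymbol n}=\boldsymbol v\cdot\boldsymbol n$, and $\{\!\{\cdot\}\!\}$ is the trace. With penalty parameters $\sigma_0,m_0$, let $\chi=\sigma_0\max(\overline{\mathbb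 D}_\kappa p_\kappa^2/h_\kappa)$ and $\gamma=m_0\max(m_{|\kappa}p_\kappa^2/h_\kappa)$ on each face, the maximum being over the one or two elements sharing it. Put $\mathcal F=\mathcal F^i\cup\mathcal F^D$ and $$\mathcal M((\boldsymbol u,\boldsymbol w),(\boldsymbol v,\boldsymbol z))=(\rho\boldsymbol u+\rho_f\boldsymbol w,\boldsymbol v)_\Omega+(\rho_f\boldsymbol u+\rho_w\boldsymbol w,\boldsymbol z)_\Omega,$$ $$\mathcal A_h^e(\boldsymbol u,\boldsymbol v)=(\boldsymbol\sigma(\boldsymbol u),\boldsymbol\epsilon(\boldsymbol v))_{\mathcal T_h}-(\{\!\{\boldsymbol\sigma(\boldsymbol u)\}\!\},[\![\boldsymbol v]\!])_{\mathcal F}-([\![\boldsymbol u]\!],\{\!\{\boldsymbol\sigma(\boldsymbol v)\}\!\})_{\mathcal F}+(\chi[\![\boldsymbol u]\!],[\![\boldsymbol v]\!])_{\mathcal F},$$ $$\mathcal A_h^p(\boldsymbol w,\boldsymbol z)=(m\nabla\!\cdot\boldsymbol w,\nabla\!\cdot\boldsymbol z)_{\mathcal T_h}-(\{\!\{m\nabla\!\cdot\boldsymbol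 w\}\!\},[\![\boldsymbol z]\!]_{\boldsymbol n})_{\mathcal F}-([\![\boldsymbol w]\!]_{\boldsymbol n},\{\!\{m\nabla\!\cdot\boldsymbol z\}\!\})_{\mathcal F}+(\gamma[\![\boldsymbol w]\!]_{\boldsymbol n},[\![\boldsymbol z]\!]_{\boldsymbol n})_{\mathcal F},$$ $$\|\boldsymbol v\|_{{\rm DG},e}^2=\|\mathbb D^{1/2}\boldsymbol\epsilon(\boldsymbol v)\|_{\mathcal T_h}^2+\|\chi^{1/2}[\![\boldsymbol v]\!]\|_{\mathcal F}^2,\qquad |\boldsymbol z|_{{\rm DG},p}^2=\|m^{1/2}\nabla\!\cdot\boldsymbol z\|_{\mathcal T_h}^2+\|\gamma^{1/2}[\![\boldsymbol z]\!]_{\boldsymbol n}\|_{\mathcal F}^2.$$ Let $T>0$ and $\boldsymbol f,\boldsymbol g\in L^2((0,T];\boldsymbol L^2(\Omega))$. A *semi-discrete solution* with initial data $(\boldsymbol u_h^0,\boldsymbol w_h^0,\boldsymbol u_h^1,\boldsymbol w_h^1)\in\boldsymbol V_h^4$ is a pair $\boldsymbol u_h,\boldsymbol w_h\in C^1([0,T];\boldsymbol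 V_h)$ with absolutely continuous time derivatives, $(\boldsymbol u_h,\boldsymbol w_h,\partial_t\boldsymbol u_h,\partial_t\boldsymbol w_h)(0)=(\boldsymbol u_h^0,\boldsymbol w_h^0,\boldsymbol u_h^1,\boldsymbol w_h^1)$, and for almost every $t\in(0,T]$ and all $\boldsymbol v,\boldsymbol z\in\boldsymbol V_h$ $$\mathcal M((\partial_{tt}\boldsymbol u_h,\partial_{tt}\boldsymbol w_h),(\boldsymbol v,\boldsymbol z))+(\tfrac{\eta}{k}\partial_t\boldsymbol w_h,\boldsymbol z)_\Omega+\mathcal A_h^e(\boldsymbol u_h,\boldsymbol v)+\mathcal A_h^p(\beta\boldsymbol u_h+\boldsymbol w_h,\beta\boldsymbol v+\boldsymbol z)=(\boldsymbol f,\boldsymbol v)_\Omega+(\boldsymbol g,\boldsymbol z)_\Omega .$$ Its energy is $$\|(\boldsymbol u_h,\boldsymbol w_h)(t)\|_{\mathcal E}^2=\|\rho_u^{1/2}\partial_t\boldsymbol u_h(t)\|_\Omega^2+\|(\rho_f\phi)^{1/2}\partial_t(\boldsymbol u_h+\phi^{-1}\boldsymbol w_h)(t)\|_\Omega^2+\|\boldsymbol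 u_h(t)\|_{{\rm DG},e}^2+|(\beta\boldsymbol u_h+\boldsymbol w_h)(t)|_{{\rm DG},p}^2+\|(\tfrac{\eta}{k})^{1/2}\boldsymbol w_h(0)\|_\Omega^2+\int_0^t\|(\tfrac{\eta}{k})^{1/2}\partial_t\boldsymbol w_h(s)\|_\Omega^2\,ds .$$ **Proposition 5.1.** For every $d\in\{2,3\}$ and $C_{\rm reg}>0$ there are thresholds $\sigma_*,m_*>0$, depending only on $d$ and $C_{\rm reg}$, such that for all $\Omega,\Gamma_D$, all polytopic-regular meshes with constant $C_{\rm reg}$, all degrees, coefficients, $T$, $\boldsymbol f,\boldsymbol g$ and initial data as above, and all $\sigma_0\ge\sigma_*$, $m_0\ge m_*$, every semi-discrete solution satisfies $$\max_{t\in[0,T]}\|(\boldsymbol u_h,\boldsymbol w_h)(t)\|_{\mathcal E}^2\le 2\Big(\int_0^T\|(k/\eta)^{1/2}\boldsymbol g(s)\|_\Omega^2\,ds+T\int_0^T\|\rho_u^{-1/2}\boldsymbol f(s)\|_\Omega^2\,ds+\mathcal E_0\Big),$$ $$\mathcal E_0=\mathcal M((\boldsymbol u_h^1,\boldsymbol w_h^1),(\boldsymbol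 u_h^1,\boldsymbol w_h^1))+\mathcal A_h^e(\boldsymbol u_h^0,\boldsymbol u_h^0)+\mathcal A_h^p(\beta\boldsymbol u_h^0+\boldsymbol w_h^0,\beta\boldsymbol u_h^0+\boldsymbol w_h^0)+\|(\eta/k)^{1/2}\boldsymbol w_h^0\|_\Omega^2 .$$ -/

import Mathlib

open MeasureTheory Set Filter Topology
open scoped BigOperators MeasureTheory

noncomputable section

namespace PolyDG

/-- The ambient Euclidean space of dimension `d`. -/
abbrev Pt (d : ℕ) : Type := EuclideanSpace ℝ (Fin d)

/-- The (closed) simplex with vertices `s 0, …, s (n-1)`. -/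
def simplex {d n : ℕ} (s : Fin n → Pt d) : Set (Pt d) := convexHull ℝ (range s)

/-- Open polygonal (`d = 2`) or polyhedral (`d = 3`) domains, not necessarily convex: connected open
sets that are the interior of a finite union of nondegenerate `d`-simplices. -/
def IsPolytope {d : ℕ} (K : Set (Pt d)) : Prop :=
  IsConnected K ∧ ∃ (N : ℕ) (s : Fin N → Fin (d + 1) → Pt d),
    (∀ i, AffineIndependent ℝ (s i)) ∧ K = interior (⋃ i, simplex (s i))

/-- The surface measure on `(d-1)`-dimensional faces (normalised Hausdorff measure). -/
def surf (d : ℕ) : Measure (Pt d) := μHE[d - 1]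

/-- A polytopic mesh of the domain `Ω`, compatible with the Dirichlet part `ΓD` of its boundary.
The elements are the sets `cell i`.  The mesh faces are nondegenerate `(d-1)`-simplices (segments
for `d = 2`, triangles for `d = 3`): an internal face is contained in the common boundary of the two
elements `plus j` and `minus j`, a boundary face has `minus j = none`. -/
structure Mesh (d : ℕ) (Ω ΓD : Set (Pt d)) where
  /-- the number of elements -/
  nE : ℕ
  /-- the number of faces -/
  nF : ℕ
  cell : Fin nE → Set (Pt d)
  cell_polytope : ∀ i, IsPolytope (cell i)
  cell_disjoint : Pairwise fun i i' => Disjoint (cell i) (cell i')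
  cell_cover : closure Ω = ⋃ i, closure (cell i)
  /-- the vertices of the faces -/
  faceVert : Fin nF → Fin d → Pt d
  faceVert_indep : ∀ j, AffineIndependent ℝ (faceVert j)
  face_overlap : Pairwise fun j j' => surf d (simplex (faceVert j) ∩ simplex (faceVert j')) = 0
  face_cover : ⋃ j, simplex (faceVert j) = ⋃ i, frontier (cell i)
  plus : Fin nF → Fin nE
  minus : Fin nF → Option (Fin nE)
  plus_frontier : ∀ j, simplex (faceVert j) ⊆ frontier (cell (plus j))
  minus_frontier : ∀ j i, minus j = some i →
    i ≠ plus j ∧ simplex (faceVert j) ⊆ frontier (cell i)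
  boundary_frontier : ∀ j, minus j = none → simplex (faceVert j) ⊆ frontier Ω
  /-- every boundary face lies, up to a set of zero surface measure, in the Dirichlet part or in the
  Neumann part of the boundary -/
  boundary_split : ∀ j, minus j = none →
    surf d (simplex (faceVert j) \ ΓD) = 0 ∨ surf d (simplex (faceVert j) ∩ ΓD) = 0
  /-- the unit normal of the face `j`, outward with respect to the element `plus j` -/
  normal : Fin nF → Pt d
  normal_unit : ∀ j, ‖normal j‖ = 1
  normal_orth : ∀ j, ∀ x ∈ simplex (faceVert j), ∀ y ∈ simplex (faceVert j),
    inner ℝ (normal j) (x - y) = 0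
  normal_outward : ∀ j, ∀ᵐ x ∂((surf d).restrict (simplex (faceVert j))),
    ∀ᶠ t : ℝ in 𝓝[>] 0, x - t • normal j ∈ cell (plus j) ∧ x + t • normal j ∉ cell (plus j)

namespace Mesh

variable {d : ℕ} {Ω ΓD : Set (Pt d)} (M : Mesh d Ω ΓD)

/-- The face `j` as a set. -/
def face (j : Fin M.nF) : Set (Pt d) := simplex (M.faceVert j)

/-- The diameter of the element `i`. -/
def h (i : Fin M.nE) : ℝ := Metric.diam (M.cell i)

/-- Polytopic regularity with constant `C`: every element `κ` contains non-overlapping `d`-simplices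
`S_κ^F`, one for each mesh face `F ⊆ ∂κ`, having `F` as a face and such that
`h_κ ≤ C d |S_κ^F| / |F|`.  The simplex is the one spanned by `F` and a further vertex. -/
def PolytopicRegular (C : ℝ) : Prop :=
  ∀ i : Fin M.nE, ∃ apex : Fin M.nF → Pt d,
    (∀ j, M.face j ⊆ frontier (M.cell i) →
      AffineIndependent ℝ (Fin.cons (apex j) (M.faceVert j) : Fin (d + 1) → Pt d) ∧
      simplex (Fin.cons (apex j) (M.faceVert j) : Fin (d + 1) → Pt d) ⊆ closure (M.cell i) ∧
      M.h i ≤ C * d *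
        volume.real (simplex (Fin.cons (apex j) (M.faceVert j) : Fin (d + 1) → Pt d)) /
          (surf d).real (M.face j)) ∧
    (∀ j j', j ≠ j' → M.face j ⊆ frontier (M.cell i) → M.face j' ⊆ frontier (M.cell i) →
      Disjoint
        (interior (simplex (Fin.cons (apex j) (M.faceVert j) : Fin (d + 1) → Pt d)))
        (interior (simplex (Fin.cons (apex j') (M.faceVert j') : Fin (d + 1) → Pt d))))

/-- The average across the face `j` of a piecewise defined quantity (its trace on boundary faces). -/
def avg {A : Type*} [AddCommGroup A] [Module ℝ A] (τ : Fin M.nE → Pt d → A) (j : Fin M.nF)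
    (x : Pt d) : A :=
  match M.minus j with
  | none => τ (M.plus j) x
  | some i => (1 / 2 : ℝ) • (τ (M.plus j) x + τ i x)

/-- The tensor jump `v⁺ ⊗ n⁺ + v⁻ ⊗ n⁻` (and `v ⊗ n` on boundary faces). -/
def jump (v : Fin M.nE → Pt d → Pt d) (j : Fin M.nF) (x : Pt d) : Matrix (Fin d) (Fin d) ℝ :=
  match M.minus j with
  | none => Matrix.vecMulVec (v (M.plus j) x) (M.normal j)
  | some i => Matrix.vecMulVec (v (M.plus j) x) (M.normal j) +
      Matrix.vecMulVec (v i x) (-M.normal j)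

/-- The normal jump `v⁺ · n⁺ + v⁻ · n⁻` (and `v · n` on boundary faces). -/
def jumpN (v : Fin M.nE → Pt d → Pt d) (j : Fin M.nF) (x : Pt d) : ℝ :=
  match M.minus j with
  | none => inner ℝ (v (M.plus j) x) (M.normal j)
  | some i => inner ℝ (v (M.plus j) x) (M.normal j) + inner ℝ (v i x) (-M.normal j)

open Classical in
/-- The set of internal and Dirichlet faces. -/
def facesID : Finset (Fin M.nF) :=
  Finset.univ.filter fun j => M.minus j ≠ none ∨ surf d (M.face j \ ΓD) = 0

/-- `∑_κ ∫_κ G` for a piecewise defined integrand. -/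
def cellInt (G : Fin M.nE → Pt d → ℝ) : ℝ := ∑ i, ∫ x in M.cell i, G i x

/-- `∑_F ∫_F G`, the sum being over the internal and Dirichlet faces. -/
def faceInt (G : Fin M.nF → Pt d → ℝ) : ℝ := ∑ j ∈ M.facesID, ∫ x in M.face j, G j x ∂(surf d)

/-- The penalization function with parameter `s` and weight `q`: `s max (q_κ p_κ² / h_κ)`, the maximum
being over the one or two elements that share the face. -/
def penalty (p : Fin M.nE → ℕ) (s : ℝ) (q : Fin M.nE → ℝ) (j : Fin M.nF) : ℝ :=
  match M.minus j with
  | none => s * (q (M.plus j) * (p (M.plus j) : ℝ) ^ 2 / M.h (M.plus j))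
  | some i => s * max (q (M.plus j) * (p (M.plus j) : ℝ) ^ 2 / M.h (M.plus j))
      (q i * (p i : ℝ) ^ 2 / M.h i)

end Mesh

/-- Exponents of the monomials in `d` variables of total degree at most `p`. -/
abbrev MonoIdx (d p : ℕ) : Type := {α : Fin d → Fin (p + 1) // ∑ k, (α k : ℕ) ≤ p}

/-- The space of piecewise polynomial vector fields of degree at most `p i` on the `i`-th element,
given by the (vector-valued) coefficients in the monomial basis. -/
abbrev Vh {d : ℕ} {Ω ΓD : Set (Pt d)} (M : Mesh d Ω ΓD) (p : Fin M.nE → ℕ) : Type :=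
  (i : Fin M.nE) → MonoIdx d (p i) → Pt d

section Fields

variable {d : ℕ} {Ω ΓD : Set (Pt d)} {M : Mesh d Ω ΓD} {p : Fin M.nE → ℕ}

/-- The piecewise polynomial field with the given coefficients: on the `i`-th element it is
`x ↦ ∑_α x^α v_{i,α}`. -/
def Vh.fn (v : Vh M p) (i : Fin M.nE) (x : Pt d) : Pt d :=
  ∑ α : MonoIdx d (p i), (∏ k, x k ^ (α.1 k : ℕ)) • v i α

end Fields

/-- The piecewise polynomial field with the elementwise constant multiplication `c v`. -/
def cmul {d : ℕ} {Ω ΓD : Set (Pt d)} {M : Mesh d Ω ΓD} {p : Fin M.nE → ℕ}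
    (c : Fin M.nE → ℝ) (v : Vh M p) : Vh M p := fun i => c i • v i

section Calculus

variable {d : ℕ}

/-- The Jacobian matrix, with entries `∂_l v_k`. -/
def grad (v : Pt d → Pt d) (x : Pt d) : Matrix (Fin d) (Fin d) ℝ :=
  Matrix.of fun k l => (fderiv ℝ v x (EuclideanSpace.single l 1)) k

/-- The divergence. -/
def divg (v : Pt d → Pt d) (x : Pt d) : ℝ := (grad v x).trace

/-- The symmetric gradient. -/
def strain (v : Pt d → Pt d) (x : Pt d) : Matrix (Fin d) (Fin d) ℝ :=
  (1 / 2 : ℝ) • (grad v x + (grad v x).transpose)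

/-- The contraction `A : B`. -/
def ddot (A B : Matrix (Fin d) (Fin d) ℝ) : ℝ := ∑ k, ∑ l, A k l * B k l

/-- Isotropic Hooke's law `𝔻 e = λ tr(e) I + 2 μ e`. -/
def hooke (lam mu : ℝ) (e : Matrix (Fin d) (Fin d) ℝ) : Matrix (Fin d) (Fin d) ℝ :=
  (lam * e.trace) • (1 : Matrix (Fin d) (Fin d) ℝ) + (2 * mu) • e

/-- The squared operator norm `|𝔻^{1/2}|₂² = sup_{|e| = 1} |𝔻^{1/2} e|² = sup_{|e| = 1} 𝔻e : e` on
the space of symmetric tensors. -/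
def hookeNorm (d : ℕ) (lam mu : ℝ) : ℝ :=
  sSup {r | ∃ e : Matrix (Fin d) (Fin d) ℝ,
    e.IsSymm ∧ ddot e e = 1 ∧ r = ddot (hooke lam mu e) e}

end Calculus

/-- Coefficients of the low-frequency poro-elastic model, constant on each of the `n` elements. -/
structure Coeff (n : ℕ) where
  /-- fluid density -/
  rhof : Fin n → ℝ
  /-- solid density -/
  rhos : Fin n → ℝ
  /-- reference porosity -/
  phi : Fin n → ℝ
  /-- tortuosity -/
  a : Fin n → ℝ
  /-- dynamic viscosity of the fluid -/
  eta : Fin n → ℝ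
  /-- absolute permeability -/
  k : Fin n → ℝ
  /-- Biot modulus -/
  m : Fin n → ℝ
  /-- Biot coefficient -/
  beta : Fin n → ℝ
  /-- first Lamé coefficient -/
  lam : Fin n → ℝ
  /-- second Lamé coefficient -/
  mu : Fin n → ℝ
  rhof_pos : ∀ i, 0 < rhof i
  rhos_pos : ∀ i, 0 < rhos i
  phi_pos : ∀ i, 0 < phi i
  phi_lt_one : ∀ i, phi i < 1
  one_lt_a : ∀ i, 1 < a i
  eta_pos : ∀ i, 0 < eta i
  k_pos : ∀ i, 0 < k i
  m_pos : ∀ i, 0 < m i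
  beta_pos : ∀ i, 0 < beta i
  beta_le_one : ∀ i, beta i ≤ 1
  lam_pos : ∀ i, 0 < lam i
  mu_pos : ∀ i, 0 < mu i

namespace Coeff

variable {n : ℕ} (c : Coeff n)

/-- The average density `ρ = φ ρ_f + (1 - φ) ρ_s`. -/
def rho (i : Fin n) : ℝ := c.phi i * c.rhof i + (1 - c.phi i) * c.rhos i

/-- `ρ_w = a φ⁻¹ ρ_f`. -/
def rhow (i : Fin n) : ℝ := c.a i * (c.phi i)⁻¹ * c.rhof i

/-- `ρ_u = ρ_s (1 - φ) / 2`. -/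
def rhou (i : Fin n) : ℝ := c.rhos i * (1 - c.phi i) / 2

end Coeff

section Forms

variable {d : ℕ} {Ω ΓD : Set (Pt d)} (M : Mesh d Ω ΓD) (p : Fin M.nE → ℕ) (c : Coeff M.nE)

/-- The weighted product `(q v, z)_Ω`, for an elementwise constant weight `q`. -/
def wip (q : Fin M.nE → ℝ) (v z : Fin M.nE → Pt d → Pt d) : ℝ :=
  M.cellInt fun i x => q i * inner ℝ (v i x) (z i x)

/-- The weighted squared norm `‖q^{1/2} v‖²_Ω`. -/
def wsq (q : Fin M.nE → ℝ) (v : Fin M.nE → Pt d → Pt d) : ℝ :=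
  M.cellInt fun i x => q i * ‖v i x‖ ^ 2

/-- The elementwise stress `σ(v)`. -/
def stress (v : Fin M.nE → Pt d → Pt d) (i : Fin M.nE) (x : Pt d) :
    Matrix (Fin d) (Fin d) ℝ :=
  hooke (c.lam i) (c.mu i) (strain (v i) x)

/-- The elementwise quantity `m ∇·v`. -/
def mdiv (v : Fin M.nE → Pt d → Pt d) (i : Fin M.nE) (x : Pt d) : ℝ :=
  c.m i * divg (v i) x

/-- The penalization function of the elastic form. -/
def penE (s0 : ℝ) : Fin M.nF → ℝ :=
  M.penalty p s0 fun i => hookeNorm d (c.lam i) (c.mu i)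

/-- The penalization function `γ` of the pressure form. -/
def penP (m0 : ℝ) : Fin M.nF → ℝ := M.penalty p m0 c.m

/-- The symmetric interior penalty form `𝒜_h^e`. -/
def formE (s0 : ℝ) (u v : Fin M.nE → Pt d → Pt d) : ℝ :=
  M.cellInt (fun i x => ddot (stress M c u i x) (strain (v i) x))
    - M.faceInt (fun j x => ddot (M.avg (stress M c u) j x) (M.jump v j x))
    - M.faceInt (fun j x => ddot (M.jump u j x) (M.avg (stress M c v) j x))
    + M.faceInt (fun j x => penE M p c s0 j * ddot (M.jump u j x) (M.jump v j x))

/-- The form `𝒜_h^p`. -/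
def formP (m0 : ℝ) (w z : Fin M.nE → Pt d → Pt d) : ℝ :=
  M.cellInt (fun i x => mdiv M c w i x * divg (z i) x)
    - M.faceInt (fun j x => M.avg (mdiv M c w) j x * M.jumpN z j x)
    - M.faceInt (fun j x => M.jumpN w j x * M.avg (mdiv M c z) j x)
    + M.faceInt (fun j x => penP M p c m0 j * (M.jumpN w j x * M.jumpN z j x))

/-- The form `ℳ^p((u, w), (v, z)) = (ρ u + ρ_f w, v) + (ρ_f u + ρ_w w, z)`. -/
def formM (u w v z : Fin M.nE → Pt d → Pt d) : ℝ :=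
  M.cellInt (fun i x => inner ℝ (c.rho i • u i x + c.rhof i • w i x) (v i x))
    + M.cellInt (fun i x => inner ℝ (c.rhof i • u i x + c.rhow i • w i x) (z i x))

/-- `‖v‖²_{DG,e} = ‖𝔻^{1/2} ε(v)‖² + ‖pen^{1/2} ⟦v⟧‖²`, where `|𝔻^{1/2} e|² = 𝔻e : e`. -/
def dgESq (s0 : ℝ) (v : Fin M.nE → Pt d → Pt d) : ℝ :=
  M.cellInt (fun i x => ddot (stress M c v i x) (strain (v i) x))
    + M.faceInt (fun j x => penE M p c s0 j * ddot (M.jump v j x) (M.jump v j x))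

/-- `|z|²_{DG,p} = ‖m^{1/2} ∇·z‖² + ‖γ^{1/2} ⟦z⟧_n‖²`. -/
def dgPSq (m0 : ℝ) (z : Fin M.nE → Pt d → Pt d) : ℝ :=
  M.cellInt (fun i x => c.m i * divg (z i) x ^ 2)
    + M.faceInt (fun j x => penP M p c m0 j * M.jumpN z j x ^ 2)

variable {M} {p}

/-- The squared energy `‖(u, w)(t)‖²_ℰ`; `ut` and `wt` are the time derivatives of `u` and `w`. -/
def energySq (s0 m0 : ℝ) (u w ut wt : ℝ → Vh M p) (t : ℝ) : ℝ :=
  wsq M c.rhou (ut t).fn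
    + wsq M (fun i => c.rhof i * c.phi i)
        (Vh.fn (ut t + cmul (fun i => (c.phi i)⁻¹) (wt t)))
    + dgESq M p c s0 (u t).fn
    + dgPSq M p c m0 (Vh.fn (cmul c.beta (u t) + w t))
    + wsq M (fun i => c.eta i / c.k i) (w 0).fn
    + ∫ s in (0 : ℝ)..t, wsq M (fun i => c.eta i / c.k i) (wt s).fn

/-- The quantity `ℰ₀`, depending on the discrete initial displacements and velocities. -/
def initialEnergy (s0 m0 : ℝ) (u0 w0 u1 w1 : Vh M p) : ℝ :=
  formM M c u1.fn w1.fn u1.fn w1.fn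
    + formE M p c s0 u0.fn u0.fn
    + formP M p c m0 (Vh.fn (cmul c.beta u0 + w0)) (Vh.fn (cmul c.beta u0 + w0))
    + wsq M (fun i => c.eta i / c.k i) w0.fn

/-- `(u, w)` solves the semi-discrete problem on `[0, T]` with sources `f, g` and initial data
`(u, w, ∂ₜu, ∂ₜw)(0) = (u0, w0, u1, w1)`.  Here `u, w` are continuously differentiable in time on
`[0, T]` with derivatives `ut, wt`, these are absolutely continuous with integrable derivatives
`utt, wtt` (the sources are only square integrable in time), and the equation holds for almost
every time. -/
structure IsSemidiscreteSolution (s0 m0 T : ℝ) (f g : ℝ → Lp (Pt d) 2 (volume.restrict Ω))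
    (u0 w0 u1 w1 : Vh M p) (u w ut wt utt wtt : ℝ → Vh M p) : Prop where
  init_u : u 0 = u0
  init_w : w 0 = w0
  init_ut : ut 0 = u1
  init_wt : wt 0 = w1
  deriv_u : ∀ t ∈ Icc 0 T, HasDerivWithinAt u (ut t) (Icc 0 T) t
  deriv_w : ∀ t ∈ Icc 0 T, HasDerivWithinAt w (wt t) (Icc 0 T) t
  int_utt : IntervalIntegrable utt volume 0 T
  int_wtt : IntervalIntegrable wtt volume 0 T
  ut_eq : ∀ t ∈ Icc 0 T, ut t = u1 + ∫ s in (0 : ℝ)..t, utt s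
  wt_eq : ∀ t ∈ Icc 0 T, wt t = w1 + ∫ s in (0 : ℝ)..t, wtt s
  equation : ∀ᵐ t ∂(volume.restrict (Ioc 0 T)), ∀ v z : Vh M p,
    formM M c (utt t).fn (wtt t).fn v.fn z.fn
      + wip M (fun i => c.eta i / c.k i) (wt t).fn z.fn
      + formE M p c s0 (u t).fn v.fn
      + formP M p c m0 (Vh.fn (cmul c.beta (u t) + w t)) (Vh.fn (cmul c.beta v + z))
      = M.cellInt (fun i x => inner ℝ (f t x) (v.fn i x))
        + M.cellInt (fun i x => inner ℝ (g t x) (z.fn i x))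

end Forms

end PolyDG

end

noncomputable section

namespace PolyDG

/-! Test the equation with the velocities (∂ₜu, ∂ₜw). All forms are symmetric, so the mechanical
energy `mechEnergy` (kinetic form plus the two interior penalty forms) has time derivative 2(f, ∂ₜu)
+ 2(g, ∂ₜw) − 2‖(η/k)^{1/2}∂ₜw‖². By Young's inequality g consumes one of the two copies of the
dissipation, and f leaves T‖ρ_u^{-1/2}f‖² + (1/T)‖ρ_u^{1/2}∂ₜu‖². Hence the energy plus the
accumulated dissipation satisfies a Gronwall inequality on [0, T] (`mechEnergy_add_le`,
`le_of_le_add_integral`). What remains is to bound the energy from below, with constants good enough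
for the final factor 2.

Coercivity. The consistency terms on faces must be absorbed under thresholds that see only d and the
regularity constant. In one variable, Markov's inequality keeps a polynomial of degree n from
decaying too fast away from its maximum, so P(1)² is at most a multiple of n² times ∫ P²
(`sq_eval_one_le_integral_weighted`). Applied on each segment from the apex of a simplex S to its
base F and integrated in polar coordinates, this gives ‖v‖ ∫_F g² ≤ c p² ∫_S g², where v is the
height vector of S (`integral_sq_base_le`). As |S| = ‖v‖ |F| / d, polytopic regularity says
precisely h ≤ C ‖v‖. The simplices of one element do not overlap, so summing over its faces costs
nothing, however many there are (`two_mul_faceInt_avg_mul_le`). Together with |𝔻e|² ≤ |𝔻^{1/2}|² 𝔻e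
: e (`ddot_hooke_hooke_le`) each penalty form is at least 7/8 of its squared DG norm.

The factor 2. Completing a square in the kinetic form leaves 2‖ρ_u^{1/2}∂ₜu‖², twice what the energy
norm needs (`Coeff.kinetic_le`). The Gronwall coefficient is therefore 1/(2T), two iterations of the
inequality give the constant 12/7, and (8/7)(12/7) = 96/49 < 2. -/

/-! ### Markov and inverse trace inequalities for polynomials in one variable -/

open Polynomial in
/-- Markov's inequality at the right endpoint of `[-1, 1]`. -/
theorem abs_eval_one_derivative_le {n : ℕ} {P : ℝ[X]} (hP : P.natDegree ≤ n) {K : ℝ}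
    (hK : ∀ x ∈ Icc (-1 : ℝ) 1, |P.eval x| ≤ K) : |P.derivative.eval 1| ≤ n ^ 2 * K := by
  have key : ∀ {Q : ℝ[X]} {K : ℝ}, 0 < K → Q.natDegree ≤ n →
      (∀ x ∈ Icc (-1 : ℝ) 1, |Q.eval x| ≤ K) → Q.derivative.eval 1 ≤ n ^ 2 * K := by
    intro Q K hK0 hQ hQK
    -- Among polynomials bounded by 1 on [-1, 1], the Chebyshev polynomial has the largest
    -- derivative at 1, and T_n'(1) = n U_{n-1}(1) = n².
    have h := Chebyshev.eval_iterate_derivative_le_of_forall_abs_le_one (n := n)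
      (P := C K⁻¹ * Q) (k := 1) (x := 1) le_rfl
      (natDegree_le_iff_degree_le.1 ((natDegree_C_mul_le _ _).trans hQ)) (fun x hx => by
        rw [eval_C_mul, abs_mul, abs_of_pos (inv_pos.2 hK0), inv_mul_le_iff₀ hK0, mul_one]
        exact hQK x hx)
    simp only [Function.iterate_one] at h
    rw [derivative_C_mul, eval_C_mul,
      Chebyshev.T_derivative_eq_U, eval_mul, eval_intCast, Chebyshev.U_eval_one,
      inv_mul_le_iff₀ hK0] at h
    push_cast at h
    nlinarith
  have hK0 : 0 ≤ K := (abs_nonneg _).trans (hK 1 (by simp))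
  refine le_of_forall_pos_le_add fun ε hε => ?_
  have hn : (0 : ℝ) < n ^ 2 + 1 := by positivity
  -- Dividing by the bound requires it to be positive, so K is enlarged slightly; after
  -- multiplication by n² the increase is at most ε.
  have hK' : ∀ x ∈ Icc (-1 : ℝ) 1, |P.eval x| ≤ K + ε / (n ^ 2 + 1) := fun x hx =>
    (hK x hx).trans (le_add_of_nonneg_right (by positivity))
  have hfin : (n : ℝ) ^ 2 * (K + ε / (n ^ 2 + 1)) ≤ n ^ 2 * K + ε := by
    have : (n : ℝ) ^ 2 * (ε / (n ^ 2 + 1)) ≤ ε := by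
      rw [mul_div_assoc', div_le_iff₀ hn]; nlinarith
    linarith [mul_add ((n : ℝ) ^ 2) K (ε / (n ^ 2 + 1))]
  refine (abs_le'.2 ⟨key (by positivity) hP hK', ?_⟩).trans hfin
  have := key (Q := -P) (K := K + ε / (n ^ 2 + 1)) (by positivity) (by rwa [natDegree_neg])
    (fun x hx => by rw [eval_neg, abs_neg]; exact hK' x hx)
  rwa [derivative_neg, eval_neg] at this

open Polynomial in
/-- Markov's inequality at the endpoint `b` of the segment between `a` and `b`. -/
theorem abs_eval_derivative_endpoint_le {n : ℕ} {P : ℝ[X]} (hP : P.natDegree ≤ n) {K a b : ℝ}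
    (hab : a ≠ b) (hK : ∀ x ∈ uIcc a b, |P.eval x| ≤ K) :
    |P.derivative.eval b| ≤ 2 * n ^ 2 * K / |b - a| := by
  set Q : ℝ[X] := P.comp (C ((b - a) / 2) * X + C ((a + b) / 2)) with hQ
  have hQe : ∀ s, Q.eval s = P.eval ((b - a) / 2 * s + (a + b) / 2) := fun s => by simp [hQ]
  have hQd : Q.natDegree ≤ n := by
    refine natDegree_comp_le.trans ?_
    calc _ ≤ P.natDegree * 1 := Nat.mul_le_mul_left _ natDegree_linear_le
      _ ≤ n := by simpa using hP
  have h := abs_eval_one_derivative_le hQd (K := K) (fun s hs => by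
    rw [hQe]; apply hK
    rcases le_total a b with h | h
    · rw [uIcc_of_le h]; constructor <;> nlinarith [hs.1, hs.2]
    · rw [uIcc_of_ge h]; constructor <;> nlinarith [hs.1, hs.2])
  have hd : Q.derivative.eval 1 = (b - a) / 2 * P.derivative.eval b := by
    rw [hQ, derivative_comp]
    simp only [derivative_add, derivative_C, derivative_C_mul, derivative_X, eval_mul, eval_comp,
      eval_add, eval_C, eval_X, mul_one, add_zero]
    congr 2; ring
  have hpos : 0 < |b - a| := abs_pos.2 (sub_ne_zero.2 hab.symm)
  rw [hd, abs_mul, abs_div, abs_two] at h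
  rw [le_div_iff₀ hpos]
  linarith

open Polynomial in
/-- Inverse trace inequality on `[1/2, 1]`. -/
theorem sq_eval_one_le_integral_half {n : ℕ} (hn : 1 ≤ n) {P : ℝ[X]} (hP : P.natDegree ≤ n) :
    P.eval 1 ^ 2 ≤ 64 * n ^ 2 * ∫ s in (1 / 2 : ℝ)..1, P.eval s ^ 2 := by
  obtain ⟨x₀, hx₀, hmax⟩ := (isCompact_Icc (a := (1 / 2 : ℝ)) (b := 1)).exists_isMaxOn
    ⟨1, by norm_num⟩ (f := fun x => |P.eval x|) (by fun_prop)
  set K := |P.eval x₀| with hKdef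
  have hK : ∀ x ∈ Icc (1 / 2 : ℝ) 1, |P.eval x| ≤ K := fun x hx => hmax hx
  have hK0 : 0 ≤ K := abs_nonneg _
  have hn0 : (1 : ℝ) ≤ n := by exact_mod_cast hn
  have hder : ∀ x ∈ Icc (1 / 2 : ℝ) 1, |P.derivative.eval x| ≤ 8 * n ^ 2 * K := by
    intro x hx
    -- Every x is at distance at least 1/4 from one end a of [1/2, 1]. Markov's inequality on the
    -- segment from a to x, at its endpoint x, gives 2n²K / (1/4).
    have aux : ∀ a ∈ Icc (1 / 2 : ℝ) 1, 1 / 4 ≤ |x - a| →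
        |P.derivative.eval x| ≤ 8 * n ^ 2 * K := by
      intro a ha hxa
      have hne : a ≠ x := by rintro rfl; norm_num at hxa
      refine (abs_eval_derivative_endpoint_le hP hne (fun y hy => hK y
        ((uIcc_subset_Icc ha hx) hy))).trans ?_
      rw [div_le_iff₀ (by linarith)]
      have : 0 ≤ (n : ℝ) ^ 2 * K := by positivity
      nlinarith
    rcases le_total x (3 / 4) with h | h
    · exact aux 1 (by norm_num) (by rw [abs_sub_comm, abs_of_nonneg] <;> linarith [hx.2])
    · exact aux (1 / 2) (by norm_num) (by rw [abs_of_nonneg] <;> linarith [hx.2])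
  -- Chosen so that the slope bound 8n²K times δ is K/2: within distance δ of the maximum point at
  -- least half of the maximum survives.
  set δ : ℝ := 1 / (16 * n ^ 2) with hδ
  have hn2 : (1 : ℝ) ≤ n ^ 2 := one_le_pow₀ hn0
  have hδ0 : 0 < δ := by positivity
  have hδ1 : δ ≤ 1 / 16 := by
    rw [hδ]; apply one_div_le_one_div_of_le <;> linarith
  have hδn : 16 * (n : ℝ) ^ 2 * δ = 1 := by rw [hδ]; field_simp
  have hlow : ∀ x ∈ Icc (1 / 2 : ℝ) 1, |x - x₀| ≤ δ → K ^ 2 / 4 ≤ P.eval x ^ 2 := by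
    intro x hx hxd
    have h := (convex_Icc (1 / 2 : ℝ) 1).norm_image_sub_le_of_norm_hasDerivWithin_le
      (f := fun x => P.eval x) (f' := fun x => P.derivative.eval x)
      (fun y _ => (P.hasDerivAt y).hasDerivWithinAt) (fun y hy => hder y hy) hx₀ hx
    rw [Real.norm_eq_abs, Real.norm_eq_abs] at h
    have h2 : |P.eval x - P.eval x₀| ≤ K / 2 := by
      refine h.trans ((mul_le_mul_of_nonneg_left hxd (by positivity)).trans (le_of_eq ?_))
      linear_combination K / 2 * hδn
    have h3 : K ≤ |P.eval x| + K / 2 := by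
      have := abs_sub_abs_le_abs_sub (P.eval x₀) (P.eval x)
      rw [abs_sub_comm] at this; linarith
    rw [← sq_abs (P.eval x)]
    nlinarith [abs_nonneg (P.eval x)]
  -- An interval of length δ with one end at x₀, extended towards the farther end of [1/2, 1]. There
  -- P² ≥ K²/4, so the integral is at least K²δ/4 = K²/(64n²).
  obtain ⟨a, ha, ha1, haδ⟩ : ∃ a : ℝ, 1 / 2 ≤ a ∧ a + δ ≤ 1 ∧
      ∀ x ∈ Icc a (a + δ), |x - x₀| ≤ δ := by
    rcases le_total x₀ (3 / 4) with h | h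
    · exact ⟨x₀, hx₀.1, by linarith, fun x hx => abs_le.2 ⟨by linarith [hx.1], by linarith [hx.2]⟩⟩
    · exact ⟨x₀ - δ, by linarith, by linarith [hx₀.2],
        fun x hx => abs_le.2 ⟨by linarith [hx.1], by linarith [hx.2]⟩⟩
  have hint : K ^ 2 / 4 * δ ≤ ∫ s in (1 / 2 : ℝ)..1, P.eval s ^ 2 := by
    calc
      K ^ 2 / 4 * δ = ∫ _s in a..(a + δ), K ^ 2 / 4 := by
        rw [intervalIntegral.integral_const, smul_eq_mul]; ring
      _ ≤ ∫ s in a..(a + δ), P.eval s ^ 2 := by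
        refine intervalIntegral.integral_mono_on (by linarith) (by simp)
          (Continuous.intervalIntegrable (by fun_prop) _ _) fun x hx => ?_
        exact hlow x ⟨ha.trans hx.1, hx.2.trans ha1⟩ (haδ x hx)
      _ ≤ _ := intervalIntegral.integral_mono_interval ha (by linarith) ha1
          (Eventually.of_forall fun x => sq_nonneg _)
          (Continuous.intervalIntegrable (by fun_prop) _ _)
  have h1 : P.eval 1 ^ 2 ≤ K ^ 2 := by
    rw [← sq_abs (P.eval 1)]
    exact pow_le_pow_left₀ (abs_nonneg _) (hK 1 (by norm_num)) 2
  calc P.eval 1 ^ 2 ≤ K ^ 2 := h1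
    _ = 64 * n ^ 2 * (K ^ 2 / 4 * δ) := by linear_combination -K ^ 2 * hδn
    _ ≤ _ := mul_le_mul_of_nonneg_left hint (by positivity)

open Polynomial in
/-- Inverse trace inequality on `[0, 1]` with the weight `s ^ m`. -/
theorem sq_eval_one_le_integral_weighted (m : ℕ) {n : ℕ} (hn : 1 ≤ n) {P : ℝ[X]}
    (hP : P.natDegree ≤ n) :
    P.eval 1 ^ 2 ≤ 64 * 2 ^ m * n ^ 2 * ∫ s in (0 : ℝ)..1, s ^ m * P.eval s ^ 2 := by
  refine (sq_eval_one_le_integral_half hn hP).trans ?_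
  -- The weight degenerates only at 0; on [1/2, 1] one has 2^m s^m ≥ 1.
  have h : ∫ s in (1 / 2 : ℝ)..1, P.eval s ^ 2 ≤
      2 ^ m * ∫ s in (0 : ℝ)..1, s ^ m * P.eval s ^ 2 := by
    rw [← intervalIntegral.integral_const_mul]
    calc _ ≤ ∫ s in (1 / 2 : ℝ)..1, 2 ^ m * (s ^ m * P.eval s ^ 2) := by
          refine intervalIntegral.integral_mono_on (by norm_num)
            (Continuous.intervalIntegrable (by fun_prop) _ _)
            (Continuous.intervalIntegrable (by fun_prop) _ _) fun x hx => ?_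
          rw [← mul_assoc, ← mul_pow]
          exact le_mul_of_one_le_left (sq_nonneg _) (one_le_pow₀ (by linarith [hx.1]))
      _ ≤ _ := by
          refine intervalIntegral.integral_mono_interval (by norm_num) (by norm_num) le_rfl ?_
            (Continuous.intervalIntegrable (by fun_prop) _ _)
          filter_upwards [ae_restrict_mem measurableSet_Ioc] with x hx
          have := hx.1.le
          positivity
  calc _ ≤ 64 * (n : ℝ) ^ 2 * (2 ^ m * ∫ s in (0 : ℝ)..1, s ^ m * P.eval s ^ 2) :=
        mul_le_mul_of_nonneg_left h (by positivity)
    _ = _ := by ring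

/-! ### Integration over a cone with a flat base -/

section Cone

variable {d : ℕ} {F : Set (Pt d)} {a v : Pt d}

theorem mem_convexJoin_singleton_iff {x : Pt d} :
    x ∈ convexJoin ℝ {a} F ↔ ∃ s ∈ Icc (0 : ℝ) 1, ∃ z ∈ F, AffineMap.homothety a s z = x := by
  simp only [mem_convexJoin, mem_singleton_iff, exists_eq_left, segment_eq_image_lineMap, mem_image,
    AffineMap.homothety_eq_lineMap]
  constructor
  · rintro ⟨z, hz, s, hs, rfl⟩; exact ⟨s, hs, z, hz, rfl⟩
  · rintro ⟨s, hs, z, hz, rfl⟩; exact ⟨z, hz, s, hs, rfl⟩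

theorem continuous_homothety_prod (a : Pt d) :
    Continuous fun q : ℝ × Pt d => AffineMap.homothety a q.1 q.2 := by
  simp only [AffineMap.homothety_apply, vsub_eq_sub, vadd_eq_add]
  fun_prop

theorem isCompact_convexJoin_singleton (hF : IsCompact F) : IsCompact (convexJoin ℝ {a} F) := by
  have : convexJoin ℝ {a} F =
      (fun q : ℝ × Pt d => AffineMap.homothety a q.1 q.2) '' (Icc (0 : ℝ) 1 ×ˢ F) := by
    ext x
    rw [mem_convexJoin_singleton_iff]
    constructor
    · rintro ⟨s, hs, z, hz, rfl⟩; exact ⟨(s, z), ⟨hs, hz⟩, rfl⟩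
    · rintro ⟨⟨s, z⟩, ⟨hs, hz⟩, rfl⟩; exact ⟨s, hs, z, hz, rfl⟩
  rw [this]
  exact (isCompact_Icc.prod hF).image (continuous_homothety_prod a)

theorem inner_homothety_sub (hF : ∀ z ∈ F, inner ℝ v (z - a) = ‖v‖ ^ 2) {z : Pt d} (hz : z ∈ F)
    (s : ℝ) : inner ℝ v (AffineMap.homothety a s z - a) = s * ‖v‖ ^ 2 := by
  rw [AffineMap.homothety_apply, vsub_eq_sub, vadd_eq_add, add_sub_cancel_right, inner_smul_right,
    hF z hz]

theorem mem_slice_iff {x : Pt d} {s : ℝ} :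
    x ∈ AffineSubspace.mk' (s • v +ᵥ a) (ℝ ∙ v)ᗮ ↔ inner ℝ v (x - a) = s * ‖v‖ ^ 2 := by
  rw [AffineSubspace.mem_mk', Submodule.mem_orthogonal_singleton_iff_inner_right, vsub_eq_sub,
    vadd_eq_add, add_comm, ← sub_sub, inner_sub_right, inner_smul_right, real_inner_self_eq_norm_sq,
    sub_eq_zero]

/-- The slices of the cone over `F`, parallel to `F`. -/
theorem cone_inter_slice (hv : v ≠ 0) (hF : ∀ z ∈ F, inner ℝ v (z - a) = ‖v‖ ^ 2)
    (A : Set (Pt d)) {s : ℝ} (hs : s ∈ Ioc (0 : ℝ) 1) :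
    convexJoin ℝ {a} F ∩ A ∩ AffineSubspace.mk' (s • v +ᵥ a) (ℝ ∙ v)ᗮ =
      AffineMap.homothety a s '' (F ∩ AffineMap.homothety a s ⁻¹' A) := by
  have hv2 : ‖v‖ ^ 2 ≠ 0 := pow_ne_zero _ (norm_ne_zero_iff.2 hv)
  ext x
  simp only [mem_inter_iff, SetLike.mem_coe, mem_slice_iff, mem_convexJoin_singleton_iff]
  constructor
  · rintro ⟨⟨⟨r, hr, z, hz, rfl⟩, hA⟩, h⟩
    rw [inner_homothety_sub hF hz] at h
    obtain rfl := mul_right_cancel₀ hv2 h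
    exact ⟨z, ⟨hz, hA⟩, rfl⟩
  · rintro ⟨z, ⟨hz, hA⟩, rfl⟩
    exact ⟨⟨⟨s, Ioc_subset_Icc_self hs, z, hz, rfl⟩, hA⟩, inner_homothety_sub hF hz s⟩

theorem cone_inter_slice_eq_empty (hv : v ≠ 0) (hF : ∀ z ∈ F, inner ℝ v (z - a) = ‖v‖ ^ 2)
    (A : Set (Pt d)) {s : ℝ} (hs : s ∉ Icc (0 : ℝ) 1) :
    convexJoin ℝ {a} F ∩ A ∩ AffineSubspace.mk' (s • v +ᵥ a) (ℝ ∙ v)ᗮ = ∅ := by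
  have hv2 : ‖v‖ ^ 2 ≠ 0 := pow_ne_zero _ (norm_ne_zero_iff.2 hv)
  ext x
  simp only [mem_inter_iff, SetLike.mem_coe, mem_slice_iff, mem_convexJoin_singleton_iff,
    mem_empty_iff_false, iff_false]
  rintro ⟨⟨⟨r, hr, z, hz, rfl⟩, hA⟩, h⟩
  rw [inner_homothety_sub hF hz] at h
  obtain rfl := mul_right_cancel₀ hv2 h
  exact hs hr

/-- The volume of a part of a cone as an integral over its slices. -/
theorem volume_cone_inter (hFc : IsCompact F) (hv : v ≠ 0)
    (hF : ∀ z ∈ F, inner ℝ v (z - a) = ‖v‖ ^ 2) {A : Set (Pt d)} (hA : MeasurableSet A) :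
    volume (convexJoin ℝ {a} F ∩ A) = ‖v‖ₑ * ∫⁻ s in Ioc (0 : ℝ) 1,
      ENNReal.ofReal (s ^ (d - 1)) * surf d (F ∩ AffineMap.homothety a s ⁻¹' A) := by
  -- Slicing orthogonally to the height vector v. The level parameter s moves along s • v, whence
  -- the factor ‖v‖; the slice at level s is the base shrunk by s, whence s^(d-1).
  have h := EuclideanGeometry.euclideanHausdorffMeasure_eq_lintegral a hv
    ((isCompact_convexJoin_singleton (a := a) hFc).measurableSet.inter hA)
  rw [InnerProductSpace.euclideanHausdorffMeasure_eq_volume, finrank_euclideanSpace_fin] at h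
  rw [h, ← lintegral_indicator measurableSet_Ioc]
  congr 1
  refine lintegral_congr_ae ?_
  -- At s = 0 the homothety collapses the base and the scaling law for its measure is not available;
  -- this single level is negligible.
  filter_upwards [compl_mem_ae_iff.2 (measure_singleton (0 : ℝ))] with s hs0
  by_cases hs : s ∈ Ioc (0 : ℝ) 1
  · rw [indicator_of_mem hs, cone_inter_slice hv hF A hs,
      euclideanHausdorffMeasure_homothety_image _ _ hs.1.ne']
    rw [ENNReal.smul_def, smul_eq_mul, surf, ENNReal.coe_pow, ENNReal.ofReal_pow hs.1.le]
    congr 2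
    exact Real.enorm_of_nonneg hs.1.le
  · rw [indicator_of_notMem hs, cone_inter_slice_eq_empty hv hF A
      (fun h => hs ⟨lt_of_le_of_ne h.1 (Ne.symm hs0), h.2⟩), measure_empty]

theorem lintegral_pow_Ioc (m : ℕ) :
    ∫⁻ s in Ioc (0 : ℝ) 1, ENNReal.ofReal (s ^ m) = ENNReal.ofReal (1 / (m + 1)) := by
  rw [← ofReal_integral_eq_lintegral_ofReal
    ((continuous_pow m).integrableOn_Icc.mono_set Ioc_subset_Icc_self)
    (by filter_upwards [ae_restrict_mem measurableSet_Ioc] with s hs using pow_nonneg hs.1.le _),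
    ← intervalIntegral.integral_of_le zero_le_one, integral_pow]
  simp

theorem volume_cone (hFc : IsCompact F) (hv : v ≠ 0)
    (hF : ∀ z ∈ F, inner ℝ v (z - a) = ‖v‖ ^ 2) (hd : 1 ≤ d) :
    volume (convexJoin ℝ {a} F) = ‖v‖ₑ * ENNReal.ofReal (1 / d) * surf d F := by
  have h := volume_cone_inter hFc hv hF MeasurableSet.univ
  simp only [preimage_univ, inter_univ] at h
  rw [h, lintegral_mul_const _ (by fun_prop), lintegral_pow_Ioc, mul_assoc]
  congr 4
  rw [Nat.cast_sub hd]; simp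

/-- The cone is compact and so has finite volume, while its volume is a positive multiple of the
measure of the base. -/
theorem surf_lt_top_of_cone (hFc : IsCompact F) (hv : v ≠ 0)
    (hF : ∀ z ∈ F, inner ℝ v (z - a) = ‖v‖ ^ 2) (hd : 1 ≤ d) : surf d F < ⊤ := by
  have h := volume_cone hFc hv hF hd
  have hfin := (isCompact_convexJoin_singleton (a := a) hFc).measure_lt_top (μ := volume)
  rw [h] at hfin
  refine lt_of_not_ge fun htop => ?_
  rw [top_le_iff.1 htop, ENNReal.mul_top] at hfin
  · exact lt_irrefl _ hfin
  · refine mul_ne_zero (by simpa using hv) ?_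
    simp only [ne_eq, ENNReal.ofReal_eq_zero, not_le]
    positivity

/-- Integration over a cone in polar coordinates with respect to its apex. -/
theorem lintegral_cone (hFc : IsCompact F) (hv : v ≠ 0)
    (hF : ∀ z ∈ F, inner ℝ v (z - a) = ‖v‖ ^ 2) (hd : 1 ≤ d) {G : Pt d → ENNReal}
    (hG : Measurable G) :
    ∫⁻ x in convexJoin ℝ {a} F, G x = ‖v‖ₑ * ∫⁻ z in F, (∫⁻ s in Ioc (0 : ℝ) 1,
      ENNReal.ofReal (s ^ (d - 1)) * G (AffineMap.homothety a s z)) ∂(surf d) := by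
  have hfin : IsFiniteMeasure ((surf d).restrict F) :=
    ⟨by simpa using surf_lt_top_of_cone hFc hv hF hd⟩
  have hS := (isCompact_convexJoin_singleton (a := a) hFc).measurableSet
  have hΦ : Measurable fun q : ℝ × Pt d => AffineMap.homothety a q.1 q.2 :=
    (continuous_homothety_prod a).measurable
  set μ : Measure ℝ := (volume.restrict (Ioc (0 : ℝ) 1)).withDensity
    fun s => ENNReal.ofReal (s ^ (d - 1)) with hμ
  have hdens : Measurable fun s : ℝ => ENNReal.ofReal (s ^ (d - 1)) := by fun_prop
  -- Polar coordinates as an identity of measures: volume on the cone is the image of s^(d-1) ds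
  -- times surface measure on the base. It suffices to check it on measurable sets, where it is
  -- `volume_cone_inter`.
  have key : volume.restrict (convexJoin ℝ {a} F) =
      ‖v‖ₑ • (μ.prod ((surf d).restrict F)).map
        (fun q : ℝ × Pt d => AffineMap.homothety a q.1 q.2) := by
    ext A hA
    rw [Measure.restrict_apply hA, inter_comm, volume_cone_inter hFc hv hF hA, Measure.smul_apply,
      Measure.map_apply hΦ hA, Measure.prod_apply (hΦ hA), hμ, smul_eq_mul]
    congr 1
    rw [lintegral_withDensity_eq_lintegral_mul _ hdens (measurable_measure_prodMk_left (hΦ hA))]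
    refine lintegral_congr fun s => ?_
    rw [Pi.mul_apply, Measure.restrict_apply (measurable_prodMk_left (hΦ hA)), inter_comm]
    rfl
  rw [key, lintegral_smul_measure, lintegral_map hG hΦ, smul_eq_mul,
    lintegral_prod_symm (fun q : ℝ × Pt d => G (AffineMap.homothety a q.1 q.2)) (hG.comp hΦ).aemeasurable]
  congr 1
  refine lintegral_congr fun z => ?_
  rw [hμ]
  exact lintegral_withDensity_eq_lintegral_mul _ hdens
    (g := fun s : ℝ => G (AffineMap.homothety a s z)) (hG.comp (hΦ.comp measurable_prodMk_right))

end Cone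

/-! ### Inverse trace inequality on cones -/

/-- Meant for the surface measure, which is not locally finite on the ambient space; finiteness on
the compact set is therefore a separate hypothesis. -/
theorem _root_.IsCompact.integrableOn_of_continuous {X : Type*} [TopologicalSpace X] [T2Space X]
    [MeasurableSpace X] [OpensMeasurableSpace X] {μ : Measure X} {K : Set X} (hK : IsCompact K)
    (hμ : μ K < ⊤) {g : X → ℝ} (hg : Continuous g) : IntegrableOn g K μ := by
  obtain ⟨C, hC⟩ := hK.exists_bound_of_continuousOn hg.continuousOn
  exact Measure.integrableOn_of_bounded hμ.ne hg.measurable.aestronglyMeasurable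
    ((ae_restrict_iff' hK.measurableSet).2 (ae_of_all _ hC))

/-- A function on `Pt d` whose restriction to every line is a polynomial of degree at most `p`. -/
def PolyOnLines {d : ℕ} (p : ℕ) (g : Pt d → ℝ) : Prop :=
  ∀ a b : Pt d, ∃ P : Polynomial ℝ, P.natDegree ≤ p ∧ ∀ s : ℝ, g (a + s • b) = P.eval s

/-- Inverse trace inequality on a cone, for functions that are polynomial along lines. -/
theorem integral_sq_base_le {d : ℕ} {F : Set (Pt d)} {a v : Pt d} (hFc : IsCompact F) (hv : v ≠ 0)
    (hF : ∀ z ∈ F, inner ℝ v (z - a) = ‖v‖ ^ 2) (hd : 1 ≤ d) {p : ℕ} (hp : 1 ≤ p) {g : Pt d → ℝ}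
    (hgc : Continuous g) (hg : PolyOnLines p g) :
    ‖v‖ * ∫ x in F, g x ^ 2 ∂(surf d) ≤
      64 * 2 ^ (d - 1) * p ^ 2 * ∫ x in convexJoin ℝ {a} F, g x ^ 2 := by
  have hfin : IsFiniteMeasure ((surf d).restrict F) :=
    ⟨by simpa using surf_lt_top_of_cone hFc hv hF hd⟩
  set K : ℝ := 64 * 2 ^ (d - 1) * p ^ 2 with hK
  have hK0 : 0 ≤ K := by positivity
  have hmeas : Measurable fun x => ENNReal.ofReal (g x ^ 2) := by fun_prop
  have hpt : ∀ z, ENNReal.ofReal (g z ^ 2) ≤ ENNReal.ofReal K * ∫⁻ s in Ioc (0 : ℝ) 1,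
      ENNReal.ofReal (s ^ (d - 1)) * ENNReal.ofReal (g (AffineMap.homothety a s z) ^ 2) := by
    intro z
    -- On the segment from the apex to z the function is a polynomial in s with z at s = 1, and the
    -- Jacobian s^(d-1) is the weight of the one-variable inequality.
    obtain ⟨P, hP, hPe⟩ := hg a (z - a)
    have hom : ∀ s : ℝ, g (AffineMap.homothety a s z) = P.eval s := fun s => by
      rw [← hPe, AffineMap.homothety_apply, vsub_eq_sub, vadd_eq_add, add_comm]
    have h1 : g z = P.eval 1 := by rw [← hom, AffineMap.homothety_one]; rfl
    have hint : ∫⁻ s in Ioc (0 : ℝ) 1,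
        ENNReal.ofReal (s ^ (d - 1)) * ENNReal.ofReal (g (AffineMap.homothety a s z) ^ 2) =
        ENNReal.ofReal (∫ s in (0 : ℝ)..1, s ^ (d - 1) * P.eval s ^ 2) := by
      rw [intervalIntegral.integral_of_le zero_le_one, ofReal_integral_eq_lintegral_ofReal]
      · refine setLIntegral_congr_fun measurableSet_Ioc fun s hs => ?_
        rw [ENNReal.ofReal_mul (pow_nonneg hs.1.le _), hom]
      · exact Continuous.integrableOn_Ioc (by fun_prop)
      · filter_upwards [ae_restrict_mem measurableSet_Ioc] with s hs
        exact mul_nonneg (pow_nonneg hs.1.le _) (sq_nonneg _)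
    rw [hint, ← ENNReal.ofReal_mul hK0, h1]
    exact ENNReal.ofReal_le_ofReal (sq_eval_one_le_integral_weighted (d - 1) hp hP)
  have hlin : ‖v‖ₑ * ∫⁻ x in F, ENNReal.ofReal (g x ^ 2) ∂(surf d) ≤
      ENNReal.ofReal K * ∫⁻ x in convexJoin ℝ {a} F, ENNReal.ofReal (g x ^ 2) := by
    rw [lintegral_cone hFc hv hF hd hmeas, mul_left_comm]
    refine mul_le_mul_right (α := ENNReal) ((lintegral_mono hpt).trans (le_of_eq ?_)) _
    rw [lintegral_const_mul']
    exact ENNReal.ofReal_ne_top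
  have hi1 : IntegrableOn (fun x => g x ^ 2) F (surf d) :=
    hFc.integrableOn_of_continuous (surf_lt_top_of_cone hFc hv hF hd) (by fun_prop)
  have hSc := isCompact_convexJoin_singleton (a := a) hFc
  have hi2 : IntegrableOn (fun x => g x ^ 2) (convexJoin ℝ {a} F) volume :=
    ContinuousOn.integrableOn_compact hSc (by fun_prop)
  rw [← ofReal_integral_eq_lintegral_ofReal hi1 (ae_of_all _ fun x => sq_nonneg _),
    ← ofReal_integral_eq_lintegral_ofReal hi2 (ae_of_all _ fun x => sq_nonneg _),
    ← ENNReal.ofReal_mul hK0, ← ofReal_norm, ← ENNReal.ofReal_mul (norm_nonneg _)] at hlin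
  exact (ENNReal.ofReal_le_ofReal_iff
    (mul_nonneg hK0 (integral_nonneg fun x => sq_nonneg _))).1 hlin

/-! ### Closure properties of functions that are polynomial along lines -/

namespace PolyOnLines

variable {d p : ℕ} {f g : Pt d → ℝ}

theorem const (c : ℝ) : PolyOnLines p (fun _ : Pt d => c) := fun _ _ =>
  ⟨Polynomial.C c, by simp, fun s => by simp⟩

theorem add (hf : PolyOnLines p f) (hg : PolyOnLines p g) : PolyOnLines p fun x => f x + g x := by
  intro a b
  obtain ⟨P, hP, hPe⟩ := hf a b
  obtain ⟨Q, hQ, hQe⟩ := hg a b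
  exact ⟨P + Q, (Polynomial.natDegree_add_le_of_degree_le hP hQ), fun s => by simp [hPe, hQe]⟩

theorem const_mul (hf : PolyOnLines p f) (c : ℝ) : PolyOnLines p fun x => c * f x := by
  intro a b
  obtain ⟨P, hP, hPe⟩ := hf a b
  exact ⟨Polynomial.C c * P, (Polynomial.natDegree_C_mul_le _ _).trans hP, fun s => by simp [hPe]⟩

theorem sum {ι : Type*} (t : Finset ι) {F : ι → Pt d → ℝ} (hF : ∀ i, PolyOnLines p (F i)) :
    PolyOnLines p fun x => ∑ i ∈ t, F i x := by
  classical
  induction t using Finset.induction_on with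
  | empty => simpa using const 0
  | insert i t hi ih =>
    simp only [Finset.sum_insert hi]
    exact (hF i).add ih

open Polynomial in
theorem monomial (α : Fin d → ℕ) (hα : ∑ k, α k ≤ p) :
    PolyOnLines p fun x : Pt d => ∏ k, x k ^ α k := by
  intro a b
  refine ⟨∏ k, (C (b k) * X + C (a k)) ^ α k, ?_, fun s => ?_⟩
  · refine (natDegree_prod_le _ _).trans ((Finset.sum_le_sum fun k _ => ?_).trans hα)
    calc _ ≤ α k * 1 := natDegree_pow_le.trans (Nat.mul_le_mul_left _ natDegree_linear_le)
      _ = α k := mul_one _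
  · simp only [eval_prod, eval_pow, eval_add, eval_mul, eval_C, eval_X, PiLp.add_apply,
      PiLp.smul_apply, smul_eq_mul]
    exact Finset.prod_congr rfl fun k _ => by ring

open Polynomial in
/-- Lagrange interpolation along lines. -/
theorem eq_sum_basis (hg : PolyOnLines p g) (a b : Pt d) (s : ℝ) :
    g (a + s • b) = ∑ j ∈ Finset.range (p + 1),
      (Lagrange.basis (Finset.range (p + 1)) (fun j : ℕ => (j : ℝ)) j).eval s *
        g (a + (j : ℝ) • b) := by
  obtain ⟨P, hP, hPe⟩ := hg a b
  have hinj : Set.InjOn (fun j : ℕ => (j : ℝ)) (Finset.range (p + 1)) :=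
    Nat.cast_injective.injOn
  have h := Lagrange.eq_interpolate (f := P) hinj (by
    rw [Finset.card_range]
    exact (degree_le_natDegree).trans_lt (by exact_mod_cast Nat.lt_succ_of_le hP))
  rw [hPe, h, Lagrange.interpolate_apply, eval_finsetSum]
  refine Finset.sum_congr rfl fun j _ => ?_
  rw [eval_mul, eval_C, hPe, mul_comm]

-- In g(x + s b) = ∑ L_j(s) g(x + j b) the Lagrange weights L_j do not depend on x. Differentiating
-- in x in the direction e gives the same interpolation formula for the derivative, which is thus
-- polynomial of degree at most p in s. The degree need not drop for the present use.
open Polynomial in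
theorem fderiv_apply (hg : PolyOnLines p g) (hd : Differentiable ℝ g) (e : Pt d) :
    PolyOnLines p fun x => fderiv ℝ g x e := by
  intro a b
  have key : ∀ s : ℝ, fderiv ℝ g (a + s • b) e = ∑ j ∈ Finset.range (p + 1),
      (Lagrange.basis (Finset.range (p + 1)) (fun j : ℕ => (j : ℝ)) j).eval s *
        fderiv ℝ g (a + (j : ℝ) • b) e := by
    intro s
    have h1 : ∀ r : ℝ, HasFDerivAt (fun x => g (x + r • b)) (fderiv ℝ g (a + r • b)) a := fun r =>
      (hasFDerivAt_comp_add_right (r • b)).2 (hd (a + r • b)).hasFDerivAt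
    have h2 := HasFDerivAt.fun_sum (u := Finset.range (p + 1)) (x := a) fun j _ =>
      (h1 (j : ℝ)).const_mul
        ((Lagrange.basis (Finset.range (p + 1)) (fun j : ℕ => (j : ℝ)) j).eval s)
    have h3 : (fun x => g (x + s • b)) = fun x => ∑ j ∈ Finset.range (p + 1),
        (Lagrange.basis (Finset.range (p + 1)) (fun j : ℕ => (j : ℝ)) j).eval s *
        g (x + (j : ℝ) • b) := funext fun x => hg.eq_sum_basis x b s
    rw [← h3] at h2
    rw [(h1 s).unique h2, sum_apply]
    simp
  refine ⟨∑ j ∈ Finset.range (p + 1),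
    Lagrange.basis (Finset.range (p + 1)) (fun j : ℕ => (j : ℝ)) j *
      C (fderiv ℝ g (a + (j : ℝ) • b) e), ?_, fun s => ?_⟩
  · refine natDegree_sum_le_of_forall_le _ _ fun j hj => ?_
    refine (natDegree_mul_C_le _ _).trans ?_
    rw [Lagrange.natDegree_basis Nat.cast_injective.injOn hj, Finset.card_range]
    simp
  · simp only [key s, eval_finsetSum, eval_mul, eval_C]

end PolyOnLines

/-! ### Algebra and regularity of the differential operators and of Hooke's law -/

section Calculus

variable {d : ℕ} {u v : Pt d → Pt d}

theorem grad_apply_eq (hv : Differentiable ℝ v) (x : Pt d) (k l : Fin d) :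
    grad v x k l = fderiv ℝ (fun y => v y k) x (EuclideanSpace.single l 1) := by
  have h : HasFDerivAt (fun y => v y k)
      ((EuclideanSpace.proj k : Pt d →L[ℝ] ℝ).comp (fderiv ℝ v x)) x :=
    (EuclideanSpace.proj k : Pt d →L[ℝ] ℝ).hasFDerivAt.comp x (hv x).hasFDerivAt
  rw [h.fderiv]
  rfl

theorem grad_add (hu : Differentiable ℝ u) (hv : Differentiable ℝ v) (x : Pt d) :
    grad (fun y => u y + v y) x = grad u x + grad v x := by
  ext k l
  simp [grad, fderiv_fun_add (hu x) (hv x)]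

theorem grad_smul (r : ℝ) (hu : Differentiable ℝ u) (x : Pt d) :
    grad (fun y => r • u y) x = r • grad u x := by
  ext k l
  simp [grad, fderiv_fun_const_smul (hu x) r]

theorem strain_add (hu : Differentiable ℝ u) (hv : Differentiable ℝ v) (x : Pt d) :
    strain (fun y => u y + v y) x = strain u x + strain v x := by
  rw [strain, strain, strain, grad_add hu hv, Matrix.transpose_add, ← smul_add]
  congr 1; abel

theorem strain_smul (r : ℝ) (hu : Differentiable ℝ u) (x : Pt d) :
    strain (fun y => r • u y) x = r • strain u x := by
  rw [strain, strain, grad_smul r hu, Matrix.transpose_smul, ← smul_add, smul_comm]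

theorem divg_add (hu : Differentiable ℝ u) (hv : Differentiable ℝ v) (x : Pt d) :
    divg (fun y => u y + v y) x = divg u x + divg v x := by
  rw [divg, grad_add hu hv, Matrix.trace_add]; rfl

theorem divg_smul (r : ℝ) (hu : Differentiable ℝ u) (x : Pt d) :
    divg (fun y => r • u y) x = r * divg u x := by
  rw [divg, grad_smul r hu, Matrix.trace_smul]; rfl

theorem hooke_add (lam mu : ℝ) (A B : Matrix (Fin d) (Fin d) ℝ) :
    hooke lam mu (A + B) = hooke lam mu A + hooke lam mu B := by
  simp only [hooke, Matrix.trace_add, mul_add, add_smul, smul_add]; abel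

theorem hooke_smul (lam mu r : ℝ) (A : Matrix (Fin d) (Fin d) ℝ) :
    hooke lam mu (r • A) = r • hooke lam mu A := by
  simp only [hooke, Matrix.trace_smul, smul_add, smul_smul, smul_eq_mul]
  congr 2 <;> ring

theorem ddot_comm (A B : Matrix (Fin d) (Fin d) ℝ) : ddot A B = ddot B A := by
  simp only [ddot, mul_comm]

theorem ddot_add_left (A B C : Matrix (Fin d) (Fin d) ℝ) :
    ddot (A + B) C = ddot A C + ddot B C := by
  simp only [ddot, Matrix.add_apply, add_mul, Finset.sum_add_distrib]

theorem ddot_smul_left (r : ℝ) (A B : Matrix (Fin d) (Fin d) ℝ) :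
    ddot (r • A) B = r * ddot A B := by
  simp only [ddot, Matrix.smul_apply, smul_eq_mul, mul_assoc, Finset.mul_sum]

theorem ddot_add_right (A B C : Matrix (Fin d) (Fin d) ℝ) :
    ddot A (B + C) = ddot A B + ddot A C := by
  rw [ddot_comm, ddot_add_left, ddot_comm B, ddot_comm C]

theorem ddot_smul_right (r : ℝ) (A B : Matrix (Fin d) (Fin d) ℝ) :
    ddot A (r • B) = r * ddot A B := by
  rw [ddot_comm, ddot_smul_left, ddot_comm B]

theorem ddot_one (A : Matrix (Fin d) (Fin d) ℝ) : ddot 1 A = A.trace := by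
  simp [ddot, Matrix.one_apply, Matrix.trace]

theorem ddot_hooke (lam mu : ℝ) (A B : Matrix (Fin d) (Fin d) ℝ) :
    ddot (hooke lam mu A) B = lam * A.trace * B.trace + 2 * mu * ddot A B := by
  rw [hooke, ddot_add_left, ddot_smul_left, ddot_smul_left, ddot_one]

theorem ddot_hooke_symm (lam mu : ℝ) (A B : Matrix (Fin d) (Fin d) ℝ) :
    ddot (hooke lam mu A) B = ddot A (hooke lam mu B) := by
  rw [ddot_comm A, ddot_hooke, ddot_hooke, ddot_comm B]; ring

theorem continuous_grad (hv : ContDiff ℝ 1 v) : Continuous (grad v) := by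
  refine continuous_matrix fun k l => ?_
  have h : Continuous fun x => fderiv ℝ v x (EuclideanSpace.single l 1) :=
    (hv.continuous_fderiv one_ne_zero).clm_apply continuous_const
  exact (EuclideanSpace.proj k : Pt d →L[ℝ] ℝ).continuous.comp h

theorem continuous_strain (hv : ContDiff ℝ 1 v) : Continuous (strain v) :=
  Continuous.fun_smul (f := fun _ => (1 / 2 : ℝ)) continuous_const
    ((continuous_grad hv).fun_add (continuous_grad hv).matrix_transpose)

theorem continuous_divg (hv : ContDiff ℝ 1 v) : Continuous (divg v) :=
  (continuous_grad hv).matrix_trace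

theorem continuous_hooke {X : Type*} [TopologicalSpace X] (lam mu : ℝ)
    {A : X → Matrix (Fin d) (Fin d) ℝ} (hA : Continuous A) :
    Continuous fun x => hooke lam mu (A x) :=
  ((continuous_const.mul hA.matrix_trace).fun_smul continuous_const).fun_add
    (continuous_const.fun_smul hA)

theorem continuous_ddot {X : Type*} [TopologicalSpace X]
    {A B : X → Matrix (Fin d) (Fin d) ℝ} (hA : Continuous A) (hB : Continuous B) :
    Continuous fun x => ddot (A x) (B x) :=
  continuous_finsetSum _ fun k _ => continuous_finsetSum _ fun l _ =>
    (hA.matrix_elem k l).mul (hB.matrix_elem k l)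

variable {p : ℕ}

theorem PolyOnLines.grad (hd : Differentiable ℝ v) (hv : ∀ k, PolyOnLines p fun x => v x k)
    (k l : Fin d) : PolyOnLines p fun x => PolyDG.grad v x k l := by
  simp only [grad_apply_eq hd]
  exact (hv k).fderiv_apply
    ((EuclideanSpace.proj k : Pt d →L[ℝ] ℝ).differentiable.comp hd) _

theorem PolyOnLines.strain (hd : Differentiable ℝ v) (hv : ∀ k, PolyOnLines p fun x => v x k)
    (k l : Fin d) : PolyOnLines p fun x => PolyDG.strain v x k l :=
  ((PolyOnLines.grad hd hv k l).add (PolyOnLines.grad hd hv l k)).const_mul (1 / 2)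

theorem PolyOnLines.divg (hd : Differentiable ℝ v) (hv : ∀ k, PolyOnLines p fun x => v x k) :
    PolyOnLines p fun x => PolyDG.divg v x :=
  PolyOnLines.sum Finset.univ fun k => PolyOnLines.grad hd hv k k

theorem PolyOnLines.hooke_strain (lam mu : ℝ) (hd : Differentiable ℝ v)
    (hv : ∀ k, PolyOnLines p fun x => v x k) (k l : Fin d) :
    PolyOnLines p fun x => hooke lam mu (PolyDG.strain v x) k l := by
  have h1 : PolyOnLines p fun x => (PolyDG.strain v x).trace :=
    PolyOnLines.sum Finset.univ fun k => PolyOnLines.strain hd hv k k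
  have h2 := ((h1.const_mul ((1 : Matrix (Fin d) (Fin d) ℝ) k l * lam))).add
    ((PolyOnLines.strain hd hv k l).const_mul (2 * mu))
  convert h2 using 2 with x
  simp only [hooke, Matrix.add_apply, Matrix.smul_apply, smul_eq_mul]
  ring

end Calculus

/-! ### Discrete fields as smooth, linewise polynomial functions -/

section Fields

variable {d : ℕ} {Ω ΓD : Set (Pt d)} {M : Mesh d Ω ΓD} {p : Fin M.nE → ℕ}

theorem Vh.fn_add (u v : Vh M p) (i : Fin M.nE) :
    (u + v).fn i = fun x => u.fn i x + v.fn i x := by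
  ext1 x
  simp only [Vh.fn, Pi.add_apply, smul_add, Finset.sum_add_distrib]

theorem Vh.fn_smul (r : ℝ) (u : Vh M p) (i : Fin M.nE) :
    (r • u).fn i = fun x => r • u.fn i x := by
  ext1 x
  simp only [Vh.fn, Pi.smul_apply, Finset.smul_sum]
  exact Finset.sum_congr rfl fun α _ => smul_comm _ _ _

theorem fn_cmul (c : Fin M.nE → ℝ) (u : Vh M p) (i : Fin M.nE) :
    Vh.fn (cmul c u) i = fun x => c i • u.fn i x := by
  ext1 x
  simp only [Vh.fn, cmul, Pi.smul_apply, Finset.smul_sum]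
  exact Finset.sum_congr rfl fun α _ => smul_comm _ _ _

theorem Vh.contDiff_fn (u : Vh M p) (i : Fin M.nE) : ContDiff ℝ 1 (u.fn i) := by
  refine ContDiff.sum fun α _ => ContDiff.fun_smul (contDiff_prod fun k _ => ContDiff.pow ?_ _)
    contDiff_const
  exact (EuclideanSpace.proj k : Pt d →L[ℝ] ℝ).contDiff

theorem Vh.differentiable_fn (u : Vh M p) (i : Fin M.nE) : Differentiable ℝ (u.fn i) :=
  (u.contDiff_fn i).differentiable one_ne_zero

theorem Vh.continuous_fn (u : Vh M p) (i : Fin M.nE) : Continuous (u.fn i) :=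
  (u.contDiff_fn i).continuous

theorem Vh.polyOnLines_fn (u : Vh M p) (i : Fin M.nE) (k : Fin d) :
    PolyOnLines (p i) fun x => u.fn i x k := by
  have h : PolyOnLines (p i) fun x : Pt d =>
      ∑ α : MonoIdx d (p i), u i α k * ∏ k, x k ^ (α.1 k : ℕ) :=
    PolyOnLines.sum _ fun α => (PolyOnLines.monomial (fun k => (α.1 k : ℕ)) α.2).const_mul _
  convert h using 2 with x
  simp only [Vh.fn, WithLp.ofLp_sum, Finset.sum_apply, PiLp.smul_apply, smul_eq_mul]
  exact Finset.sum_congr rfl fun α _ => mul_comm _ _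

end Fields

/-! ### Geometry of elements and faces -/

section Simplex

variable {d : ℕ}

theorem isCompact_simplex {n : ℕ} (s : Fin n → Pt d) : IsCompact (simplex s) :=
  (finite_range s).isCompact_convexHull (𝕜 := ℝ)

theorem simplex_cons {n : ℕ} (a : Pt d) (s : Fin (n + 1) → Pt d) :
    simplex (Fin.cons a s : Fin (n + 2) → Pt d) = convexJoin ℝ {a} (simplex s) := by
  rw [simplex, Fin.range_cons, convexHull_insert (range_nonempty s)]
  rfl

theorem IsPolytope.isOpen {K : Set (Pt d)} (hK : IsPolytope K) : IsOpen K := by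
  obtain ⟨-, N, s, -, rfl⟩ := hK
  exact isOpen_interior

theorem IsPolytope.isBounded {K : Set (Pt d)} (hK : IsPolytope K) : Bornology.IsBounded K := by
  obtain ⟨-, N, s, -, rfl⟩ := hK
  exact ((isCompact_iUnion fun i => isCompact_simplex (s i)).isBounded).subset interior_subset

/-- A polytope is the interior of a closed set, hence regular open. This turns inclusions between
closures, as they occur in the definitions of mesh and of regularity, into inclusions of open
elements. -/
theorem IsPolytope.interior_closure {K : Set (Pt d)} (hK : IsPolytope K) :
    interior (closure K) = K := by
  refine Subset.antisymm ?_ (hK.isOpen.subset_interior_iff.2 subset_closure)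
  obtain ⟨-, N, s, -, rfl⟩ := hK
  exact interior_mono (closure_minimal interior_subset
    (isCompact_iUnion fun i => isCompact_simplex (s i)).isClosed)

end Simplex

namespace Mesh

variable {d : ℕ} {Ω ΓD : Set (Pt d)} (M : Mesh d Ω ΓD)

theorem isOpen_cell (i : Fin M.nE) : IsOpen (M.cell i) := (M.cell_polytope i).isOpen

theorem cell_subset (hΩ : IsPolytope Ω) (i : Fin M.nE) : M.cell i ⊆ Ω := by
  have h : interior (closure (M.cell i)) ⊆ interior (closure Ω) :=
    interior_mono (M.cell_cover ▸ subset_iUnion (fun i => closure (M.cell i)) i)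
  rwa [(M.cell_polytope i).interior_closure, hΩ.interior_closure] at h

theorem isCompact_closure_cell (i : Fin M.nE) : IsCompact (closure (M.cell i)) :=
  (M.cell_polytope i).isBounded.isCompact_closure

theorem h_pos (hd : 1 ≤ d) (i : Fin M.nE) : 0 < M.h i := by
  have : Nonempty (Fin d) := ⟨⟨0, hd⟩⟩
  obtain ⟨x, hx⟩ := (M.cell_polytope i).1.1
  have hinf : (M.cell i).Infinite := infinite_of_mem_nhds x ((M.isOpen_cell i).mem_nhds hx)
  exact Metric.diam_pos hinf.nontrivial (M.cell_polytope i).isBounded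

theorem integrableOn_cell (i : Fin M.nE) {g : Pt d → ℝ} (hg : Continuous g) :
    IntegrableOn g (M.cell i) :=
  ((M.isCompact_closure_cell i).integrableOn_of_continuous
    (M.isCompact_closure_cell i).measure_lt_top hg).mono_set subset_closure

theorem isCompact_face (j : Fin M.nF) : IsCompact (M.face j) := isCompact_simplex _

theorem faceVert_mem_face (j : Fin M.nF) (k : Fin d) : M.faceVert j k ∈ M.face j :=
  subset_convexHull ℝ _ (mem_range_self k)

/-- Any cone over the face will do; here the apex is a vertex shifted by the unit normal, so that
the normal itself is the height vector. -/
theorem surf_face_lt_top (hd : 1 ≤ d) (j : Fin M.nF) : surf d (M.face j) < ⊤ := by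
  have hn := M.normal_unit j
  refine surf_lt_top_of_cone (a := M.faceVert j ⟨0, hd⟩ - M.normal j) (v := M.normal j)
    (M.isCompact_face j) (by rintro h; simp [h] at hn) (fun z hz => ?_) hd
  rw [← sub_add, inner_add_right, M.normal_orth j z hz _ (M.faceVert_mem_face j _),
    real_inner_self_eq_norm_sq, zero_add]

theorem integrableOn_face (hd : 1 ≤ d) (j : Fin M.nF) {g : Pt d → ℝ} (hg : Continuous g) :
    IntegrableOn g (M.face j) (surf d) :=
  (M.isCompact_face j).integrableOn_of_continuous (M.surf_face_lt_top hd j) hg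

/-- The simplex with base `M.face j` and the given apex is a cone over the face with nonzero
height. -/
theorem exists_height (hd : 1 ≤ d) (j : Fin M.nF) {a : Pt d}
    (ha : AffineIndependent ℝ (Fin.cons a (M.faceVert j) : Fin (d + 1) → Pt d)) :
    ∃ v : Pt d, v ≠ 0 ∧ ∀ z ∈ M.face j, inner ℝ v (z - a) = ‖v‖ ^ 2 := by
  set n := M.normal j with hn
  have hn1 : ‖n‖ = 1 := M.normal_unit j
  set z₀ := M.faceVert j ⟨0, hd⟩ with hz₀
  have hz₀m : z₀ ∈ M.face j := M.faceVert_mem_face j _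
  set τ : ℝ := inner ℝ n (z₀ - a) with hτ
  have hlevel : ∀ z ∈ M.face j, inner ℝ n (z - a) = τ := fun z hz => by
    have := M.normal_orth j z hz z₀ hz₀m
    rw [hτ, ← sub_add_sub_cancel z z₀ a, inner_add_right, this, zero_add]
  -- If the apex were at height zero, all d + 1 vertices would lie in one hyperplane, although
  -- affinely independent they span the whole space.
  have hτ0 : τ ≠ 0 := by
    intro h0
    have htop := (ha.affineSpan_eq_top_iff_card_eq_finrank_add_one).2 (by simp)
    have hle : affineSpan ℝ (range (Fin.cons a (M.faceVert j) : Fin (d + 1) → Pt d)) ≤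
        AffineSubspace.mk' a (ℝ ∙ n)ᗮ := by
      rw [affineSpan_le, Fin.range_cons]
      rintro x (rfl | ⟨k, rfl⟩)
      · exact AffineSubspace.self_mem_mk' _ _
      · rw [SetLike.mem_coe, AffineSubspace.mem_mk',
          Submodule.mem_orthogonal_singleton_iff_inner_right, vsub_eq_sub,
          hlevel _ (M.faceVert_mem_face j k), h0]
    have hmem : n +ᵥ a ∈ AffineSubspace.mk' a (ℝ ∙ n)ᗮ := hle (htop ▸ AffineSubspace.mem_top ..)
    rw [AffineSubspace.mem_mk', Submodule.mem_orthogonal_singleton_iff_inner_right,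
      vadd_vsub, real_inner_self_eq_norm_sq, hn1] at hmem
    norm_num at hmem
  refine ⟨τ • n, smul_ne_zero hτ0 (by rintro h; simp [h] at hn1), fun z hz => ?_⟩
  rw [inner_smul_left, hlevel z hz, norm_smul, hn1, mul_one, Real.norm_eq_abs, sq_abs, sq]
  rfl

/-- Inverse trace inequality from a face to the simplex of a polytopic-regular element. -/
theorem h_mul_integral_face_sq_le (hd : 1 ≤ d) {C : ℝ} (hC : 0 < C) (j : Fin M.nF) {a : Pt d}
    (ha : AffineIndependent ℝ (Fin.cons a (M.faceVert j) : Fin (d + 1) → Pt d)) {h : ℝ}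
    (hh : h ≤ C * d * volume.real (simplex (Fin.cons a (M.faceVert j) : Fin (d + 1) → Pt d)) /
      (surf d).real (M.face j)) {p : ℕ} (hp : 1 ≤ p) {g : Pt d → ℝ} (hgc : Continuous g)
    (hg : PolyOnLines p g) :
    h * ∫ x in M.face j, g x ^ 2 ∂(surf d) ≤ 64 * 2 ^ (d - 1) * C * p ^ 2 *
      ∫ x in interior (simplex (Fin.cons a (M.faceVert j) : Fin (d + 1) → Pt d)), g x ^ 2 := by
  obtain ⟨v, hv, hF⟩ := M.exists_height hd j ha
  obtain ⟨n, rfl⟩ := Nat.exists_eq_add_of_le' hd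
  have hnull : volume (frontier (simplex (Fin.cons a (M.faceVert j) : Fin (n + 2) → Pt (n + 1))))
      = 0 := (convex_convexHull ℝ _).addHaar_frontier _
  rw [setIntegral_congr_set (interior_ae_eq_of_null_frontier hnull)]
  rw [simplex_cons] at hh ⊢
  have hFc := M.isCompact_face j
  have htr := integral_sq_base_le hFc hv hF hd hp hgc hg
  have hI : 0 ≤ ∫ x in M.face j, g x ^ 2 ∂(surf (n + 1)) := integral_nonneg fun x => sq_nonneg _
  have hS : 0 ≤ ∫ x in convexJoin ℝ {a} (M.face j), g x ^ 2 := integral_nonneg fun x => sq_nonneg _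
  -- For a face of zero measure the quotient |S| / |F| is a division by zero and carries no
  -- information, but the face integral vanishes.
  rcases eq_or_ne ((surf (n + 1)).real (M.face j)) 0 with h0 | h0
  · have : surf (n + 1) (M.face j) = 0 :=
      (measureReal_eq_zero_iff (M.surf_face_lt_top hd j).ne).1 h0
    rw [Measure.restrict_eq_zero.2 this, integral_zero_measure, mul_zero]
    exact mul_nonneg (by positivity) hS
  · have hvol : volume.real (convexJoin ℝ {a} (M.face j)) =
        ‖v‖ / ((n + 1 : ℕ) : ℝ) * (surf (n + 1)).real (M.face j) := by
      rw [measureReal_def, volume_cone hFc hv hF hd, ENNReal.toReal_mul, ENNReal.toReal_mul,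
        toReal_enorm, ENNReal.toReal_ofReal (by positivity), mul_one_div]
      rfl
    -- With |S| = ‖v‖ |F| / d the regularity condition is a comparison of the element diameter with
    -- the height of the simplex over the face.
    have hhC : h ≤ C * ‖v‖ := by
      refine hh.trans (le_of_eq ?_)
      change C * _ * volume.real (convexJoin ℝ {a} (M.face j)) / _ = _
      rw [hvol]
      have : ((n + 1 : ℕ) : ℝ) ≠ 0 := by positivity
      field_simp
    calc h * ∫ x in M.face j, g x ^ 2 ∂(surf (n + 1))
        ≤ C * ‖v‖ * ∫ x in M.face j, g x ^ 2 ∂(surf (n + 1)) := mul_le_mul_of_nonneg_right hhC hI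
      _ = C * (‖v‖ * ∫ x in M.face j, g x ^ 2 ∂(surf (n + 1))) := by ring
      _ ≤ C * _ := mul_le_mul_of_nonneg_left htr hC.le
      _ = _ := by
        change _ = _ * ∫ x in convexJoin ℝ {a} (M.face j), g x ^ 2
        ring

/-- The elements that share the face `j`. -/
def sides (j : Fin M.nF) : Finset (Fin M.nE) := insert (M.plus j) (M.minus j).toFinset

theorem face_subset_frontier {j : Fin M.nF} {i : Fin M.nE} (hi : i ∈ M.sides j) :
    M.face j ⊆ frontier (M.cell i) := by
  rw [sides, Finset.mem_insert, Option.mem_toFinset, Option.mem_def] at hi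
  rcases hi with rfl | hi
  · exact M.plus_frontier j
  · exact (M.minus_frontier j i hi).2

/-- Polytopic regularity in the form in which it is used: the trace of a function that is polynomial
along lines is controlled, on every face of an element, by the function in a part of the element, and
the parts belonging to different faces do not overlap. -/
theorem PolytopicRegular.exists_parts {M : Mesh d Ω ΓD} {C : ℝ} (hM : M.PolytopicRegular C)
    (hd : 1 ≤ d) (hC : 0 < C) :
    ∃ S : Fin M.nE → Fin M.nF → Set (Pt d),
      (∀ i j, i ∈ M.sides j → IsOpen (S i j) ∧ S i j ⊆ M.cell i ∧
        ∀ (p : ℕ) (g : Pt d → ℝ), 1 ≤ p → Continuous g → PolyOnLines p g →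
          M.h i * ∫ x in M.face j, g x ^ 2 ∂(surf d) ≤
            64 * 2 ^ (d - 1) * C * p ^ 2 * ∫ x in S i j, g x ^ 2) ∧
      ∀ i j j', j ≠ j' → i ∈ M.sides j → i ∈ M.sides j' → Disjoint (S i j) (S i j') := by
  choose apex h1 h2 using hM
  refine ⟨fun i j => interior
    (simplex (Fin.cons (apex i j) (M.faceVert j) : Fin (d + 1) → Pt d)), fun i j hi => ?_,
    fun i j j' hjj hj hj' => h2 i j j' hjj (M.face_subset_frontier hj)
      (M.face_subset_frontier hj')⟩
  obtain ⟨ha, hsub, hh⟩ := h1 i j (M.face_subset_frontier hi)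
  refine ⟨isOpen_interior, ?_, fun p g hp hgc hg => M.h_mul_integral_face_sq_le hd hC j ha hh hp hgc hg⟩
  rw [← (M.cell_polytope i).interior_closure]
  exact interior_mono hsub

/-- Non-overlap of the simplices enters here: it keeps the number of faces of an element out of
every constant. -/
theorem sum_integral_parts_le {S : Fin M.nE → Fin M.nF → Set (Pt d)} {i : Fin M.nE}
    {J : Finset (Fin M.nF)} (hS : ∀ j ∈ J, IsOpen (S i j) ∧ S i j ⊆ M.cell i)
    (hdisj : ∀ j ∈ J, ∀ j' ∈ J, j ≠ j' → Disjoint (S i j) (S i j')) {e : Pt d → ℝ}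
    (he : Continuous e) (he0 : ∀ x, 0 ≤ e x) :
    ∑ j ∈ J, ∫ x in S i j, e x ≤ ∫ x in M.cell i, e x := by
  rw [← integral_biUnion_finset J (fun j hj => (hS j hj).1.measurableSet)
    (fun j hj j' hj' hne => hdisj j hj j' hj' hne)
    (fun j hj => (M.integrableOn_cell i he).mono_set (hS j hj).2)]
  exact setIntegral_mono_set (M.integrableOn_cell i he) (ae_of_all _ he0)
    (iUnion₂_subset fun j hj => (hS j hj).2).eventuallyLE

end Mesh

/-! ### Absorbing the face terms into the cell and penalty terms -/

namespace Mesh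

variable {d : ℕ} {Ω ΓD : Set (Pt d)} (M : Mesh d Ω ΓD)

theorem sides_of_none {j : Fin M.nF} (h : M.minus j = none) : M.sides j = {M.plus j} := by
  simp [sides, h]

theorem sides_of_some {j : Fin M.nF} {i : Fin M.nE} (h : M.minus j = some i) :
    M.sides j = {M.plus j, i} := by
  simp [sides, h]

theorem le_penalty (p : Fin M.nE → ℕ) {s : ℝ} (hs : 0 ≤ s) (q : Fin M.nE → ℝ) {j : Fin M.nF}
    {i : Fin M.nE} (hi : i ∈ M.sides j) :
    s * (q i * (p i : ℝ) ^ 2 / M.h i) ≤ M.penalty p s q j := by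
  rcases h : M.minus j with _ | i'
  · rw [M.sides_of_none h, Finset.mem_singleton] at hi
    subst hi
    simp [penalty, h]
  · rw [M.sides_of_some h, Finset.mem_insert, Finset.mem_singleton] at hi
    simp only [penalty, h]
    refine mul_le_mul_of_nonneg_left ?_ hs
    rcases hi with rfl | rfl
    · exact le_max_left _ _
    · exact le_max_right _ _

theorem plus_mem_sides (j : Fin M.nF) : M.plus j ∈ M.sides j := Finset.mem_insert_self _ _

theorem penalty_nonneg (hd : 1 ≤ d) (p : Fin M.nE → ℕ) {s : ℝ} (hs : 0 ≤ s) {q : Fin M.nE → ℝ}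
    (hq : ∀ i, 0 ≤ q i) (j : Fin M.nF) : 0 ≤ M.penalty p s q j :=
  (mul_nonneg hs (div_nonneg (mul_nonneg (hq _) (sq_nonneg _)) (M.h_pos hd _).le)).trans
    (M.le_penalty p hs q (M.plus_mem_sides j))

/-- Young's inequality for the product of an average and a jump. -/
theorem two_mul_avg_mul_le (τ : Fin M.nE → Pt d → ℝ) (J : ℝ) (j : Fin M.nF) (x : Pt d) {P : ℝ}
    {r : Fin M.nE → ℝ} (hr : ∀ i ∈ M.sides j, 0 < r i) (hP : ∀ i ∈ M.sides j, r i ≤ P) :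
    2 * (M.avg τ j x * J) ≤ ∑ i ∈ M.sides j, (r i)⁻¹ * τ i x ^ 2 + P * J ^ 2 := by
  have key : ∀ i ∈ M.sides j, 2 * (τ i x * J) ≤ (r i)⁻¹ * τ i x ^ 2 + P * J ^ 2 := by
    intro i hi
    have h1 := hr i hi
    have h2 : 0 ≤ (r i)⁻¹ * (τ i x - r i * J) ^ 2 := by positivity
    have h3 : (r i)⁻¹ * (τ i x - r i * J) ^ 2 =
        (r i)⁻¹ * τ i x ^ 2 - 2 * (τ i x * J) + r i * J ^ 2 := by
      field_simp
      ring
    nlinarith [mul_le_mul_of_nonneg_right (hP i hi) (sq_nonneg J)]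
  have hpos : ∀ i ∈ M.sides j, 0 ≤ (r i)⁻¹ * τ i x ^ 2 := fun i hi =>
    mul_nonneg (inv_nonneg.2 (hr i hi).le) (sq_nonneg _)
  rcases h : M.minus j with _ | i'
  · have hs := M.sides_of_none h
    rw [hs] at key hpos ⊢
    simp only [avg, h, Finset.sum_singleton]
    exact key _ (Finset.mem_singleton_self _)
  · have hs := M.sides_of_some h
    rw [hs] at key hpos ⊢
    -- The mean of the one-sided estimates is the claim with a spare factor 1/2 on the sum over the
    -- sides, which is discarded by positivity.
    have k1 := key _ (Finset.mem_insert_self _ _)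
    have k2 := key i' (by simp)
    have p1 := hpos _ (Finset.mem_insert_self _ _)
    have p2 := hpos i' (by simp)
    rw [Finset.sum_pair (M.minus_frontier j i' h).1.symm]
    simp only [avg, h, smul_eq_mul]
    nlinarith

theorem continuous_avg {τ : Fin M.nE → Pt d → ℝ} (hτ : ∀ i, Continuous (τ i)) (j : Fin M.nF) :
    Continuous (M.avg τ j) := by
  unfold avg
  rcases M.minus j with _ | i'
  · exact hτ _
  · exact continuous_const.fun_smul ((hτ _).fun_add (hτ _))

/-- The common core of both coercivity estimates: ι indexes the entries of a tensor in the elastic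
case and is a single point in the pressure case. Young's inequality is weighted on each side by the
share of that side in the penalty; the powers of h, p and q then cancel against the trace inequality
and `hτe`, leaving a constant in d, C, ε and s only. -/
theorem two_mul_faceInt_avg_mul_le {C : ℝ} (hM : M.PolytopicRegular C) (hd : 1 ≤ d) (hC : 0 < C)
    {p : Fin M.nE → ℕ} (hp : ∀ i, 1 ≤ p i) {ι : Type*} [Fintype ι]
    {τ : ι → Fin M.nE → Pt d → ℝ} (hτc : ∀ k i, Continuous (τ k i))
    (hτ : ∀ k i, PolyOnLines (p i) (τ k i)) {e : Fin M.nE → Pt d → ℝ} (hec : ∀ i, Continuous (e i))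
    {q : Fin M.nE → ℝ} (hq : ∀ i, 0 < q i) (hτe : ∀ i x, ∑ k, τ k i x ^ 2 ≤ q i * e i x)
    {J : ι → Fin M.nF → Pt d → ℝ} (hJ : ∀ k j, Continuous (J k j)) {s ε : ℝ} (hs : 0 < s)
    (hε : 0 < ε) :
    2 * M.faceInt (fun j x => ∑ k, M.avg (τ k) j x * J k j x) ≤
      64 * 2 ^ (d - 1) * C / (ε * s) * M.cellInt e +
        ε * M.faceInt (fun j x => M.penalty p s q j * ∑ k, J k j x ^ 2) := by
  obtain ⟨S, hS, hSd⟩ := hM.exists_parts hd hC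
  set K : ℝ := 64 * 2 ^ (d - 1) * C with hK
  have hK0 : 0 < K := by positivity
  have he0 : ∀ i x, 0 ≤ e i x := fun i x => by
    have h : 0 ≤ q i * e i x := (Finset.sum_nonneg fun k _ => sq_nonneg _).trans (hτe i x)
    exact nonneg_of_mul_nonneg_right h (hq i)
  have hp2 : ∀ i, 0 < (p i : ℝ) ^ 2 := fun i => by
    have : 0 < (p i : ℝ) := by exact_mod_cast hp i
    positivity
  -- The penalty on a face is a maximum over its sides, so this weight is at most ε times the
  -- penalty from either side.
  set r : Fin M.nE → ℝ := fun i => ε * (s * (q i * (p i : ℝ) ^ 2 / M.h i)) with hr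
  have hr0 : ∀ i, 0 < r i := fun i =>
    mul_pos hε (mul_pos hs (div_pos (mul_pos (hq i) (hp2 i)) (M.h_pos hd i)))
  have hsq : ∀ k i, Continuous fun x => τ k i x ^ 2 := fun k i => (hτc k i).pow 2
  have hside : ∀ j, ∀ i ∈ M.sides j,
      ∫ x in M.face j, (r i)⁻¹ * ∑ k, τ k i x ^ 2 ∂(surf d) ≤
        K / (ε * s) * ∫ x in S i j, e i x := by
    intro j i hi
    obtain ⟨hSo, hSc, htr⟩ := hS i j hi
    have hτi : ∀ k, IntegrableOn (fun x => τ k i x ^ 2) (S i j) := fun k =>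
      (M.integrableOn_cell i (hsq k i)).mono_set hSc
    have h1 : M.h i * ∫ x in M.face j, ∑ k, τ k i x ^ 2 ∂(surf d) ≤
        K * p i ^ 2 * ∫ x in S i j, ∑ k, τ k i x ^ 2 := by
      rw [integral_finsetSum _ fun k _ => M.integrableOn_face hd j (hsq k i),
        integral_finsetSum _ fun k _ => hτi k, Finset.mul_sum, Finset.mul_sum]
      exact Finset.sum_le_sum fun k _ => htr (p i) (τ k i) (hp i) (hτc k i) (hτ k i)
    have h2 : ∫ x in S i j, ∑ k, τ k i x ^ 2 ≤ q i * ∫ x in S i j, e i x := by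
      rw [← integral_const_mul]
      exact integral_mono (integrable_finsetSum _ fun k _ => hτi k)
        (((M.integrableOn_cell i (hec i)).mono_set hSc).const_mul _) fun x => hτe i x
    rw [integral_const_mul]
    have hrv : (r i)⁻¹ = M.h i / (ε * s * q i * p i ^ 2) := by
      simp only [hr]
      rw [mul_div_assoc', mul_div_assoc', inv_div]
      congr 1; ring
    have hden : 0 < ε * s * q i * (p i : ℝ) ^ 2 :=
      mul_pos (mul_pos (mul_pos hε hs) (hq i)) (hp2 i)
    calc (r i)⁻¹ * ∫ x in M.face j, ∑ k, τ k i x ^ 2 ∂(surf d)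
        = (M.h i * ∫ x in M.face j, ∑ k, τ k i x ^ 2 ∂(surf d)) / (ε * s * q i * p i ^ 2) := by
          rw [hrv]; ring
      _ ≤ (K * p i ^ 2 * (q i * ∫ x in S i j, e i x)) / (ε * s * q i * p i ^ 2) := by
          refine div_le_div_of_nonneg_right (h1.trans ?_) hden.le
          exact mul_le_mul_of_nonneg_left h2 (by positivity)
      _ = K / (ε * s) * ∫ x in S i j, e i x := by
          have := (hq i).ne'
          have : (p i : ℝ) ≠ 0 := (pow_ne_zero_iff two_ne_zero).1 (hp2 i).ne'
          field_simp
  have hface : ∀ j, 2 * ∫ x in M.face j, ∑ k, M.avg (τ k) j x * J k j x ∂(surf d) ≤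
      (∑ i ∈ M.sides j, K / (ε * s) * ∫ x in S i j, e i x) +
        ε * ∫ x in M.face j, M.penalty p s q j * ∑ k, J k j x ^ 2 ∂(surf d) := by
    intro j
    have hA : Continuous fun x => ∑ k, M.avg (τ k) j x * J k j x :=
      continuous_finsetSum _ fun k _ => (M.continuous_avg (hτc k) j).mul (hJ k j)
    have hB : ∀ i, Continuous fun x => (r i)⁻¹ * ∑ k, τ k i x ^ 2 := fun i =>
      continuous_const.mul (continuous_finsetSum _ fun k _ => (hτc k i).pow 2)
    have hD : Continuous fun x => M.penalty p s q j * ∑ k, J k j x ^ 2 :=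
      continuous_const.mul (continuous_finsetSum _ fun k _ => (hJ k j).pow 2)
    calc 2 * ∫ x in M.face j, ∑ k, M.avg (τ k) j x * J k j x ∂(surf d)
        = ∫ x in M.face j, 2 * ∑ k, M.avg (τ k) j x * J k j x ∂(surf d) :=
          (integral_const_mul _ _).symm
      _ ≤ ∫ x in M.face j, (∑ i ∈ M.sides j, (r i)⁻¹ * ∑ k, τ k i x ^ 2 +
            ε * (M.penalty p s q j * ∑ k, J k j x ^ 2)) ∂(surf d) := by
          refine integral_mono ((M.integrableOn_face hd j hA).const_mul _)
            ((integrable_finsetSum _ fun i _ => M.integrableOn_face hd j (hB i)).add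
              ((M.integrableOn_face hd j hD).const_mul _)) fun x => ?_
          simp only [Finset.mul_sum]
          rw [Finset.sum_comm, ← Finset.sum_add_distrib]
          refine Finset.sum_le_sum fun k _ => ?_
          rw [← mul_assoc]
          rw [← mul_assoc ε]
          have := M.two_mul_avg_mul_le (τ k) (J k j x) j x (P := ε * M.penalty p s q j) (r := r)
            (fun i _ => hr0 i)
            (fun i hi => mul_le_mul_of_nonneg_left (M.le_penalty p hs.le q hi) hε.le)
          linarith
      _ = (∑ i ∈ M.sides j, ∫ x in M.face j, (r i)⁻¹ * ∑ k, τ k i x ^ 2 ∂(surf d)) +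
            ε * ∫ x in M.face j, M.penalty p s q j * ∑ k, J k j x ^ 2 ∂(surf d) := by
          rw [integral_add (integrable_finsetSum _ fun i _ => M.integrableOn_face hd j (hB i))
            ((M.integrableOn_face hd j hD).const_mul _),
            integral_finsetSum _ fun i _ => M.integrableOn_face hd j (hB i), integral_const_mul]
      _ ≤ _ := add_le_add_left (Finset.sum_le_sum fun i hi => hside j i hi) _
  have hcell : ∑ j ∈ M.facesID, ∑ i ∈ M.sides j, ∫ x in S i j, e i x ≤ M.cellInt e := by
    -- Regrouping by elements instead of faces: each element then meets its own disjoint parts.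
    rw [Finset.sum_comm' (t' := Finset.univ)
      (s' := fun i => M.facesID.filter fun j => i ∈ M.sides j) (by simp)]
    refine Finset.sum_le_sum fun i _ => M.sum_integral_parts_le (fun j hj => ?_)
      (fun j hj j' hj' hne => ?_) (hec i) (he0 i)
    · have := hS i j (Finset.mem_filter.1 hj).2
      exact ⟨this.1, this.2.1⟩
    · exact hSd i j j' hne (Finset.mem_filter.1 hj).2 (Finset.mem_filter.1 hj').2
  rw [faceInt, faceInt, Finset.mul_sum, Finset.mul_sum]
  refine (Finset.sum_le_sum fun j _ => hface j).trans ?_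
  rw [Finset.sum_add_distrib]
  refine add_le_add_left ?_ _
  simp only [← Finset.mul_sum]
  exact mul_le_mul_of_nonneg_left hcell (by positivity)

end Mesh

/-! ### Bounds for Hooke's law by its operator norm -/

section Hooke

variable {d : ℕ}

theorem ddot_self (A : Matrix (Fin d) (Fin d) ℝ) : ddot A A = ∑ k : Fin d × Fin d, A k.1 k.2 ^ 2 := by
  rw [Fintype.sum_prod_type]
  simp only [ddot, sq]

theorem ddot_self_nonneg (A : Matrix (Fin d) (Fin d) ℝ) : 0 ≤ ddot A A := by
  rw [ddot_self]; positivity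

theorem ddot_hooke_self_nonneg {lam mu : ℝ} (hl : 0 ≤ lam) (hm : 0 ≤ mu)
    (A : Matrix (Fin d) (Fin d) ℝ) : 0 ≤ ddot (hooke lam mu A) A := by
  rw [ddot_hooke]
  have := ddot_self_nonneg A
  have : 0 ≤ lam * A.trace * A.trace := by
    rw [mul_assoc]; exact mul_nonneg hl (mul_self_nonneg _)
  positivity

theorem trace_sq_le (A : Matrix (Fin d) (Fin d) ℝ) : A.trace ^ 2 ≤ d * ddot A A := by
  have h := sq_sum_le_card_mul_sum_sq (s := Finset.univ) (f := fun k => A k k)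
  rw [Finset.card_univ, Fintype.card_fin] at h
  refine h.trans (mul_le_mul_of_nonneg_left (Finset.sum_le_sum fun k _ => ?_) (Nat.cast_nonneg _))
  simp only [sq]
  exact Finset.single_le_sum (f := fun l => A k l * A k l) (fun l _ => mul_self_nonneg _)
    (Finset.mem_univ k)

/-- Needed for the supremum in `hookeNorm` to be an actual upper bound; it comes from (tr e)² ≤ d
|e|². -/
theorem bddAbove_hooke {lam mu : ℝ} (hl : 0 ≤ lam) :
    BddAbove {r | ∃ e : Matrix (Fin d) (Fin d) ℝ,
      e.IsSymm ∧ ddot e e = 1 ∧ r = ddot (hooke lam mu e) e} := by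
  refine ⟨lam * d + 2 * mu, ?_⟩
  rintro r ⟨e, -, he, rfl⟩
  have h := trace_sq_le e
  rw [he] at h
  rw [ddot_hooke, he]
  nlinarith

/-- By homogeneity: A scaled to unit length competes in the supremum. Symmetry is required because
only symmetric tensors compete. -/
theorem ddot_hooke_self_le {lam mu : ℝ} (hl : 0 ≤ lam)
    {A : Matrix (Fin d) (Fin d) ℝ} (hA : A.IsSymm) :
    ddot (hooke lam mu A) A ≤ hookeNorm d lam mu * ddot A A := by
  rcases (ddot_self_nonneg A).eq_or_lt with h0 | h0
  · have hA0 : A = 0 := by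
      rw [ddot_self, eq_comm, Finset.sum_eq_zero_iff_of_nonneg fun _ _ => sq_nonneg _] at h0
      ext k l
      exact pow_eq_zero_iff two_ne_zero |>.1 (h0 (k, l) (Finset.mem_univ _))
    subst hA0
    simp [ddot]
  · set t : ℝ := (Real.sqrt (ddot A A))⁻¹ with ht
    have ht2 : t * (t * ddot A A) = 1 := by
      have hs := Real.mul_self_sqrt h0.le
      have hs0 : Real.sqrt (ddot A A) ≠ 0 := (Real.sqrt_pos.2 h0).ne'
      rw [ht]; nth_rewrite 3 [← hs]; field_simp
    have hle : ddot (hooke lam mu (t • A)) (t • A) ≤ hookeNorm d lam mu :=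
      le_csSup (bddAbove_hooke hl)
        ⟨t • A, hA.smul t, by rw [ddot_smul_left, ddot_smul_right, ht2], rfl⟩
    rw [hooke_smul, ddot_smul_left, ddot_smul_right] at hle
    calc ddot (hooke lam mu A) A = t * (t * ddot (hooke lam mu A) A) * ddot A A := by
          linear_combination -ddot (hooke lam mu A) A * ht2
      _ ≤ _ := mul_le_mul_of_nonneg_right hle h0.le

/-- The identity tensor is a test tensor with positive energy. -/
theorem hookeNorm_pos (hd : 1 ≤ d) {lam mu : ℝ} (hl : 0 ≤ lam) (hm : 0 < mu) :
    0 < hookeNorm d lam mu := by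
  have h := ddot_hooke_self_le (d := d) (mu := mu) hl (Matrix.isSymm_one)
  rw [ddot_hooke, ddot_one, Matrix.trace_one, Fintype.card_fin] at h
  have hd0 : (0 : ℝ) < d := by exact_mod_cast hd
  have h1 : 0 < lam * d * d + 2 * mu * d := by positivity
  exact (mul_pos_iff_of_pos_right hd0).1 (h1.trans_le h)

theorem isSymm_hooke (lam mu : ℝ) {A : Matrix (Fin d) (Fin d) ℝ} (hA : A.IsSymm) :
    (hooke lam mu A).IsSymm :=
  (Matrix.isSymm_one.smul _).add (hA.smul _)

theorem isSymm_strain (v : Pt d → Pt d) (x : Pt d) : (strain v x).IsSymm := by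
  refine Matrix.IsSymm.smul ?_ _
  rw [Matrix.IsSymm, Matrix.transpose_add, Matrix.transpose_transpose, add_comm]

/-- The stress is controlled by the elastic energy density. -/
theorem ddot_hooke_hooke_le {lam mu : ℝ} (hl : 0 ≤ lam) (hm : 0 ≤ mu)
    (hN : 0 < hookeNorm d lam mu) {A : Matrix (Fin d) (Fin d) ℝ} (hA : A.IsSymm) :
    ddot (hooke lam mu A) (hooke lam mu A) ≤ hookeNorm d lam mu * ddot (hooke lam mu A) A := by
  set N := hookeNorm d lam mu
  set B := hooke lam mu A with hB
  -- A substitute for the square root of 𝔻: with B = 𝔻A, nonnegativity of 𝔻 at B − N A reads 𝔻B : B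
  -- − 2N B : B + N² B : A ≥ 0. Inserting 𝔻B : B ≤ N B : B and dividing by N gives the claim.
  have h1 := ddot_hooke_self_nonneg hl hm (B + (-N) • A)
  have h2 := ddot_hooke_self_le (mu := mu) hl (isSymm_hooke lam mu hA)
  have h3 : ddot (hooke lam mu B) A = ddot B B := by rw [ddot_hooke_symm]
  rw [hooke_add, hooke_smul, ddot_add_left, ddot_add_right, ddot_add_right, ddot_smul_left,
    ddot_smul_left, ddot_smul_right, ddot_smul_right, ← hB, h3] at h1
  change ddot (hooke lam mu B) B ≤ N * ddot B B at h2
  nlinarith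

end Hooke

/-! ### Coercivity of the interior penalty forms -/

section Coercivity

variable {d : ℕ} {Ω ΓD : Set (Pt d)} {M : Mesh d Ω ΓD} {p : Fin M.nE → ℕ} (c : Coeff M.nE)

theorem Mesh.continuous_jump {v : Fin M.nE → Pt d → Pt d} (hv : ∀ i, Continuous (v i))
    (j : Fin M.nF) : Continuous (M.jump v j) := by
  have h : ∀ i, Continuous fun x => (v i x).ofLp := fun i =>
    (PiLp.continuous_ofLp 2 _).comp (hv i)
  unfold Mesh.jump
  rcases M.minus j with _ | i'
  · exact (h _).matrix_vecMulVec continuous_const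
  · exact ((h _).matrix_vecMulVec continuous_const).fun_add
      ((h _).matrix_vecMulVec continuous_const)

theorem Mesh.continuous_jumpN {v : Fin M.nE → Pt d → Pt d} (hv : ∀ i, Continuous (v i))
    (j : Fin M.nF) : Continuous (M.jumpN v j) := by
  unfold Mesh.jumpN
  rcases M.minus j with _ | i'
  · exact (hv _).inner continuous_const
  · exact ((hv _).inner continuous_const).fun_add ((hv _).inner continuous_const)

theorem Mesh.avg_matrix_apply (τ : Fin M.nE → Pt d → Matrix (Fin d) (Fin d) ℝ) (j : Fin M.nF)
    (x : Pt d) (k l : Fin d) : M.avg τ j x k l = M.avg (fun i x => τ i x k l) j x := by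
  unfold Mesh.avg
  rcases M.minus j with _ | i' <;> rfl

theorem Mesh.cellInt_nonneg {G : Fin M.nE → Pt d → ℝ} (hG : ∀ i x, 0 ≤ G i x) :
    0 ≤ M.cellInt G :=
  Finset.sum_nonneg fun i _ => integral_nonneg (hG i)

theorem Mesh.faceInt_nonneg {G : Fin M.nF → Pt d → ℝ} (hG : ∀ j x, 0 ≤ G j x) :
    0 ≤ M.faceInt G :=
  Finset.sum_nonneg fun j _ => integral_nonneg (hG j)

theorem continuous_stress (u : Vh M p) (i : Fin M.nE) : Continuous (stress M c u.fn i) :=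
  continuous_hooke _ _ (continuous_strain (u.contDiff_fn i))

theorem continuous_mdiv (u : Vh M p) (i : Fin M.nE) : Continuous (mdiv M c u.fn i) :=
  continuous_const.mul (continuous_divg (u.contDiff_fn i))

/-- By symmetry the two consistency terms amount to twice one of them. Write K = 64 · 2^(d-1) · C.
With ε = 1/8 they take at most 8K/s0 of the cell term and 1/8 of the penalty term, and s0 ≥ 64K
makes the first share at most 1/8 as well. -/
theorem dgESq_le_formE {C : ℝ} (hM : M.PolytopicRegular C) (hd : 1 ≤ d) (hC : 0 < C)
    (hp : ∀ i, 1 ≤ p i) {s0 : ℝ} (hs : 64 * (64 * 2 ^ (d - 1) * C) ≤ s0) (u : Vh M p) :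
    7 / 8 * dgESq M p c s0 u.fn ≤ formE M p c s0 u.fn u.fn := by
  have hK : 0 < 64 * 2 ^ (d - 1) * C := by positivity
  have hs0 : 0 < s0 := by linarith
  have h := M.two_mul_faceInt_avg_mul_le hM hd hC hp (ι := Fin d × Fin d)
    (τ := fun k i x => stress M c u.fn i x k.1 k.2)
    (fun k i => (continuous_stress c u i).matrix_elem k.1 k.2)
    (fun k i => PolyOnLines.hooke_strain _ _ (u.differentiable_fn i) (u.polyOnLines_fn i) k.1 k.2)
    (e := fun i x => ddot (stress M c u.fn i x) (strain (u.fn i) x))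
    (fun i => continuous_ddot (continuous_stress c u i) (continuous_strain (u.contDiff_fn i)))
    (q := fun i => hookeNorm d (c.lam i) (c.mu i))
    (fun i => hookeNorm_pos hd (c.lam_pos i).le (c.mu_pos i))
    (fun i x => by
      rw [← ddot_self]
      exact ddot_hooke_hooke_le (c.lam_pos i).le (c.mu_pos i).le
        (hookeNorm_pos hd (c.lam_pos i).le (c.mu_pos i)) (isSymm_strain _ _))
    (J := fun k j x => M.jump u.fn j x k.1 k.2)
    (fun k j => (M.continuous_jump u.continuous_fn j).matrix_elem k.1 k.2)
    (s := s0) (ε := 1 / 8) hs0 (by norm_num)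
  have h1 : ∀ j x, ∑ k : Fin d × Fin d, M.avg (fun i x => stress M c u.fn i x k.1 k.2) j x *
      M.jump u.fn j x k.1 k.2 = ddot (M.avg (stress M c u.fn) j x) (M.jump u.fn j x) := by
    intro j x
    rw [Fintype.sum_prod_type, ddot]
    simp only [Mesh.avg_matrix_apply]
  simp only [h1, ← ddot_self] at h
  have hX : 0 ≤ M.cellInt fun i x => ddot (stress M c u.fn i x) (strain (u.fn i) x) :=
    M.cellInt_nonneg fun i x => ddot_hooke_self_nonneg (c.lam_pos i).le (c.mu_pos i).le _
  have hcoef : 64 * 2 ^ (d - 1) * C / (1 / 8 * s0) ≤ 1 / 8 := by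
    rw [div_le_iff₀ (by positivity)]; linarith
  have hle := mul_le_mul_of_nonneg_right hcoef hX
  have hsymm : (fun j x => ddot (M.jump u.fn j x) (M.avg (stress M c u.fn) j x)) =
      fun j x => ddot (M.avg (stress M c u.fn) j x) (M.jump u.fn j x) := by
    funext j x; exact ddot_comm _ _
  rw [dgESq, formE, hsymm]
  simp only [penE] at h ⊢
  linarith

/-- The scalar counterpart: for τ = m ∇·w the bound of τ² by the energy density is the identity (m
∇·w)² = m · m(∇·w)². -/
theorem dgPSq_le_formP {C : ℝ} (hM : M.PolytopicRegular C) (hd : 1 ≤ d) (hC : 0 < C)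
    (hp : ∀ i, 1 ≤ p i) {m0 : ℝ} (hm : 64 * (64 * 2 ^ (d - 1) * C) ≤ m0) (w : Vh M p) :
    7 / 8 * dgPSq M p c m0 w.fn ≤ formP M p c m0 w.fn w.fn := by
  have hK : 0 < 64 * 2 ^ (d - 1) * C := by positivity
  have hm0 : 0 < m0 := by linarith
  have h := M.two_mul_faceInt_avg_mul_le hM hd hC hp (ι := Unit)
    (τ := fun _ => mdiv M c w.fn) (fun _ i => continuous_mdiv c w i)
    (fun _ i => (PolyOnLines.divg (w.differentiable_fn i) (w.polyOnLines_fn i)).const_mul _)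
    (e := fun i x => c.m i * divg (w.fn i) x ^ 2)
    (fun i => continuous_const.mul ((continuous_divg (w.contDiff_fn i)).pow 2))
    (q := c.m) c.m_pos
    (fun i x => by
      simp only [Finset.univ_unique, Finset.sum_singleton, mdiv]
      exact le_of_eq (by ring))
    (J := fun _ => M.jumpN w.fn) (fun _ j => M.continuous_jumpN w.continuous_fn j)
    (s := m0) (ε := 1 / 8) hm0 (by norm_num)
  simp only [Finset.univ_unique, Finset.sum_singleton] at h
  have hX : 0 ≤ M.cellInt fun i x => c.m i * divg (w.fn i) x ^ 2 :=
    M.cellInt_nonneg fun i x => mul_nonneg (c.m_pos i).le (sq_nonneg _)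
  have hcoef : 64 * 2 ^ (d - 1) * C / (1 / 8 * m0) ≤ 1 / 8 := by
    rw [div_le_iff₀ (by positivity)]; linarith
  have hle := mul_le_mul_of_nonneg_right hcoef hX
  have hsymm : (fun j x => M.jumpN w.fn j x * M.avg (mdiv M c w.fn) j x) =
      fun j x => M.avg (mdiv M c w.fn) j x * M.jumpN w.fn j x := by
    funext j x; exact mul_comm _ _
  have hcell : (fun i x => mdiv M c w.fn i x * divg (w.fn i) x) =
      fun i x => c.m i * divg (w.fn i) x ^ 2 := by
    funext i x; simp only [mdiv]; ring
  rw [dgPSq, formP, hsymm, hcell]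
  simp only [penP, ← sq] at h ⊢
  linarith

theorem dgESq_nonneg (hd : 1 ≤ d) {s0 : ℝ} (hs : 0 ≤ s0) (u : Vh M p) :
    0 ≤ dgESq M p c s0 u.fn :=
  add_nonneg
    (M.cellInt_nonneg fun i _ => ddot_hooke_self_nonneg (c.lam_pos i).le (c.mu_pos i).le _)
    (M.faceInt_nonneg fun j _ => mul_nonneg (M.penalty_nonneg hd p hs
      (fun i => (hookeNorm_pos hd (c.lam_pos i).le (c.mu_pos i)).le) j) (ddot_self_nonneg _))

theorem dgPSq_nonneg (hd : 1 ≤ d) {m0 : ℝ} (hm : 0 ≤ m0) (w : Vh M p) :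
    0 ≤ dgPSq M p c m0 w.fn :=
  add_nonneg
    (M.cellInt_nonneg fun i _ => mul_nonneg (c.m_pos i).le (sq_nonneg _))
    (M.faceInt_nonneg fun j _ => mul_nonneg (M.penalty_nonneg hd p hm
      (fun i => (c.m_pos i).le) j) (sq_nonneg _))

end Coercivity

/-! ### Symmetric bilinear forms on finite-dimensional spaces -/

/-- Linearity of a form in its first argument. -/
structure LeftLinear {V W : Type*} [AddCommGroup V] [Module ℝ V] (B : V → W → ℝ) : Prop where
  add : ∀ u u' v, B (u + u') v = B u v + B u' v
  smul : ∀ (r : ℝ) u v, B (r • u) v = r * B u v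

/-- Symmetric bilinear forms. -/
structure IsSymmBilin {V : Type*} [AddCommGroup V] [Module ℝ V] (B : V → V → ℝ) : Prop
    extends LeftLinear B where
  symm : ∀ u v, B u v = B v u

namespace LeftLinear

variable {V W V' W' : Type*} [AddCommGroup V] [Module ℝ V] [AddCommGroup V'] [Module ℝ V']
  {B B' : V → W → ℝ}

theorem add_form (hB : LeftLinear B) (hB' : LeftLinear B') :
    LeftLinear fun u v => B u v + B' u v :=
  ⟨fun u u' v => by rw [hB.add, hB'.add]; ring, fun r u v => by rw [hB.smul, hB'.smul]; ring⟩

theorem sub_form (hB : LeftLinear B) (hB' : LeftLinear B') :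
    LeftLinear fun u v => B u v - B' u v :=
  ⟨fun u u' v => by rw [hB.add, hB'.add]; ring, fun r u v => by rw [hB.smul, hB'.smul]; ring⟩

theorem comp (hB : LeftLinear B) (L : V' →ₗ[ℝ] V) (L' : W' → W) :
    LeftLinear fun u v => B (L u) (L' v) :=
  ⟨fun u u' v => by rw [map_add, hB.add], fun r u v => by rw [map_smul, hB.smul]⟩

/-- The linear functional obtained by fixing the second argument. -/
def toLinearMap (hB : LeftLinear B) (v : W) : V →ₗ[ℝ] ℝ where
  toFun u := B u v
  map_add' u u' := hB.add u u' v
  map_smul' r u := hB.smul r u v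

end LeftLinear

namespace IsSymmBilin

variable {V V' : Type*} [AddCommGroup V] [Module ℝ V] [AddCommGroup V'] [Module ℝ V']
  {B B' : V → V → ℝ}

theorem add_form (hB : IsSymmBilin B) (hB' : IsSymmBilin B') :
    IsSymmBilin fun u v => B u v + B' u v :=
  { hB.toLeftLinear.add_form hB'.toLeftLinear with
    symm := fun u v => by rw [hB.symm, hB'.symm] }

theorem comp (hB : IsSymmBilin B) (L : V' →ₗ[ℝ] V) : IsSymmBilin fun u v => B (L u) (L v) :=
  { hB.toLeftLinear.comp L L with symm := fun _ _ => hB.symm _ _ }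

/-- Expansion of a symmetric bilinear form in a basis. -/
theorem eq_sum {V : Type*} [AddCommGroup V] [Module ℝ V] {B : V → V → ℝ} (hB : IsSymmBilin B)
    {ι : Type*} [Fintype ι] (b : Module.Basis ι ℝ V) (u v : V) :
    B u v = ∑ i, b.repr u i * hB.toLinearMap (b i) v := by
  have h := congrArg (hB.toLinearMap v) (b.sum_repr u).symm
  rw [map_sum] at h
  change B u v = _ at h
  rw [h]
  refine Finset.sum_congr rfl fun i _ => ?_
  rw [map_smul, smul_eq_mul]
  change _ * B (b i) v = _ * B v (b i)
  rw [hB.symm]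

variable {V : Type*} [NormedAddCommGroup V] [NormedSpace ℝ V] [FiniteDimensional ℝ V]
  {B : V → V → ℝ}

theorem continuous (hB : IsSymmBilin B) : Continuous fun q : V × V => B q.1 q.2 := by
  set b := Module.finBasis ℝ V
  have h : (fun q : V × V => B q.1 q.2) =
      fun q : V × V => ∑ i, b.coord i q.1 * hB.toLinearMap (b i) q.2 :=
    funext fun q => hB.eq_sum b q.1 q.2
  rw [h]
  exact continuous_finsetSum _ fun i _ =>
    ((b.coord i).continuous_of_finiteDimensional.comp continuous_fst).mul
      ((hB.toLinearMap (b i)).continuous_of_finiteDimensional.comp continuous_snd)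

end IsSymmBilin

/-! ### Calculus in time for absolutely continuous curves, and the Gronwall bound -/

section Time

/-- The product rule for primitives of integrable functions. -/
theorem mul_eq_add_integral {T : ℝ} (hT : 0 ≤ T) {f g f' g' : ℝ → ℝ} {f₀ g₀ : ℝ}
    (hf' : IntervalIntegrable f' volume 0 T) (hg' : IntervalIntegrable g' volume 0 T)
    (hf : ∀ t ∈ Icc 0 T, f t = f₀ + ∫ s in (0 : ℝ)..t, f' s)
    (hg : ∀ t ∈ Icc 0 T, g t = g₀ + ∫ s in (0 : ℝ)..t, g' s) :
    IntervalIntegrable (fun s => f' s * g s + f s * g' s) volume 0 T ∧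
      ∀ t ∈ Icc 0 T, f t * g t = f₀ * g₀ + ∫ s in (0 : ℝ)..t, (f' s * g s + f s * g' s) := by
  have hcont : ∀ {k k' : ℝ → ℝ} {k₀ : ℝ}, IntervalIntegrable k' volume 0 T →
      (∀ t ∈ Icc 0 T, k t = k₀ + ∫ s in (0 : ℝ)..t, k' s) → ContinuousOn k (uIcc 0 T) := by
    intro k k' k₀ hk' hk
    have h := (hk'.absolutelyContinuousOnInterval_intervalIntegral left_mem_uIcc).continuousOn
    refine ((continuousOn_const (c := k₀)).fun_add h).congr fun t ht => ?_
    rw [uIcc_of_le hT] at ht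
    exact hk t ht
  refine ⟨(hf'.mul_continuousOn (hcont hg' hg)).add (hg'.continuousOn_mul (hcont hf' hf)),
    fun t ht => ?_⟩
  have hsub : uIcc 0 t ⊆ uIcc 0 T := by
    rw [uIcc_of_le hT, uIcc_of_le ht.1]; exact Icc_subset_Icc_right ht.2
  have hf't := hf'.mono_set hsub
  have hg't := hg'.mono_set hsub
  have hac : ∀ {k' : ℝ → ℝ} (k₀ : ℝ), IntervalIntegrable k' volume 0 t →
      AbsolutelyContinuousOnInterval (fun x => k₀ + ∫ s in (0 : ℝ)..x, k' s) 0 t := by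
    intro k' k₀ hk'
    have hc : AbsolutelyContinuousOnInterval (fun _ : ℝ => k₀) 0 t :=
      (contDiff_const.contDiffOn).absolutelyContinuousOnInterval
    exact hc.fun_add (hk'.absolutelyContinuousOnInterval_intervalIntegral left_mem_uIcc)
  -- Integration by parts for absolutely continuous functions involves their derivatives, which
  -- agree with the given integrands only almost everywhere, by Lebesgue differentiation.
  have h := (hac f₀ hf't).integral_deriv_mul_eq_sub (hac g₀ hg't)
  simp only [intervalIntegral.integral_same, add_zero] at h
  rw [hf t ht, hg t ht, ← sub_eq_iff_eq_add', ← h]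
  refine intervalIntegral.integral_congr_ae ?_
  filter_upwards [hf't.ae_hasDerivAt_integral, hg't.ae_hasDerivAt_integral] with x hx1 hx2 hx
  have hx' := uIoc_subset_uIcc hx
  have d1 := ((hx1 hx' 0 left_mem_uIcc).const_add f₀).deriv
  have d2 := ((hx2 hx' 0 left_mem_uIcc).const_add g₀).deriv
  have hxT : x ∈ Icc 0 T := by
    have := hsub hx'
    rwa [uIcc_of_le hT] at this
  rw [d1, d2, hf x hxT, hg x hxT]

variable {V : Type*} [NormedAddCommGroup V] [NormedSpace ℝ V] [FiniteDimensional ℝ V]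

/-- The fundamental theorem of calculus for quadratic forms of absolutely continuous curves. -/
theorem IsSymmBilin.self_eq_add_integral {B : V → V → ℝ} (hB : IsSymmBilin B) {T : ℝ} (hT : 0 ≤ T)
    {U U' : ℝ → V} {U₀ : V} (hU' : IntervalIntegrable U' volume 0 T)
    (hU : ∀ t ∈ Icc 0 T, U t = U₀ + ∫ s in (0 : ℝ)..t, U' s) :
    IntervalIntegrable (fun s => 2 * B (U' s) (U s)) volume 0 T ∧
      ∀ t ∈ Icc 0 T, B (U t) (U t) = B U₀ U₀ + ∫ s in (0 : ℝ)..t, 2 * B (U' s) (U s) := by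
  have : CompleteSpace V := FiniteDimensional.complete ℝ V
  set b := Module.finBasis ℝ V
  have hlin : ∀ φ : V →ₗ[ℝ] ℝ, IntervalIntegrable (fun s => φ (U' s)) volume 0 T ∧
      ∀ t ∈ Icc 0 T, φ (U t) = φ U₀ + ∫ s in (0 : ℝ)..t, φ (U' s) := by
    intro φ
    have hφ : ∀ s, LinearMap.toContinuousLinearMap φ (U' s) = φ (U' s) := fun s => rfl
    refine ⟨⟨(LinearMap.toContinuousLinearMap φ).integrable_comp hU'.1,
      (LinearMap.toContinuousLinearMap φ).integrable_comp hU'.2⟩, fun t ht => ?_⟩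
    have hsub : uIcc 0 t ⊆ uIcc 0 T := by
      rw [uIcc_of_le hT, uIcc_of_le ht.1]; exact Icc_subset_Icc_right ht.2
    rw [hU t ht, map_add]
    congr 1
    exact ((LinearMap.toContinuousLinearMap φ).intervalIntegral_comp_comm
      (hU'.mono_set hsub)).symm
  -- In a basis, B(U, U) is the sum of the products of coord_i(U) and B(b_i, U), two scalar
  -- absolutely continuous functions. After the product rule, symmetry merges the two sums into 2
  -- B(U', U).
  have hpair := fun i => mul_eq_add_integral hT (hlin (b.coord i)).1
    (hlin (hB.toLinearMap (b i))).1 (hlin (b.coord i)).2 (hlin (hB.toLinearMap (b i))).2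
  have heq : (fun s => 2 * B (U' s) (U s)) = fun s => ∑ i,
      (b.coord i (U' s) * hB.toLinearMap (b i) (U s) +
        b.coord i (U s) * hB.toLinearMap (b i) (U' s)) := by
    funext s
    rw [Finset.sum_add_distrib]
    have h1 := hB.eq_sum b (U' s) (U s)
    have h2 := hB.eq_sum b (U s) (U' s)
    rw [hB.symm] at h2
    simp only [Module.Basis.coord_apply]
    rw [← h1, ← h2]; ring
  rw [heq]
  refine ⟨by simpa only [Finset.sum_fn] using IntervalIntegrable.sum Finset.univ fun i _ => (hpair i).1,
    fun t ht => ?_⟩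
  have hsub : uIcc 0 t ⊆ uIcc 0 T := by
    rw [uIcc_of_le hT, uIcc_of_le ht.1]; exact Icc_subset_Icc_right ht.2
  rw [intervalIntegral.integral_finsetSum fun i _ => (hpair i).1.mono_set hsub, hB.eq_sum b,
    hB.eq_sum b U₀, ← Finset.sum_add_distrib]
  exact Finset.sum_congr rfl fun i _ => (hpair i).2 t ht

/-- A Gronwall-type bound on a time interval of length at most `T`. -/
theorem le_of_le_add_integral {T K : ℝ} (hT : 0 < T) {Q : ℝ → ℝ} (hQ : ContinuousOn Q (Icc 0 T))
    (hK : 0 ≤ K)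
    (h : ∀ t ∈ Icc 0 T, Q t ≤ K + 1 / (2 * T) * ∫ s in (0 : ℝ)..t, Q s) :
    ∀ t ∈ Icc 0 T, Q t ≤ 12 / 7 * K := by
  obtain ⟨t₀, ht₀, hmax⟩ := isCompact_Icc.exists_isMaxOn ⟨0, left_mem_Icc.2 hT.le⟩ hQ
  set r := Q t₀ with hr
  have hQr : ∀ t ∈ Icc 0 T, Q t ≤ r := fun t ht => hmax ht
  have hint : ∀ t ∈ Icc 0 T, IntervalIntegrable Q volume 0 t := fun t ht =>
    (hQ.mono (by rw [uIcc_of_le ht.1]; exact Icc_subset_Icc_right ht.2)).intervalIntegrable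
  -- Stopping after one substitution of the maximum r would give r ≤ K + r/2, that is 2K, which is
  -- too weak once divided by the coercivity constant 7/8.
  have step1 : ∀ t ∈ Icc 0 T, Q t ≤ K + r / (2 * T) * t := by
    intro t ht
    have h1 : ∫ s in (0 : ℝ)..t, Q s ≤ ∫ _s in (0 : ℝ)..t, r :=
      intervalIntegral.integral_mono_on ht.1 (hint t ht) (by simp) fun s hs =>
        hQr s ⟨hs.1, hs.2.trans ht.2⟩
    rw [intervalIntegral.integral_const, smul_eq_mul, sub_zero] at h1
    calc Q t ≤ _ := h t ht
      _ ≤ K + 1 / (2 * T) * (t * r) := by gcongr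
      _ = _ := by ring
  -- Inserting the linear bound into the integral once more gives r ≤ K + K/2 + |r|/8, hence r ≤
  -- (12/7) K when r ≥ 0. The absolute value appears since the sign of r is not known here.
  have step2 : r ≤ K + 1 / (2 * T) * (K * T + |r| / (2 * T) * (T ^ 2 / 2)) := by
    have h1 : ∫ s in (0 : ℝ)..t₀, Q s ≤ ∫ s in (0 : ℝ)..t₀, (K + r / (2 * T) * s) :=
      intervalIntegral.integral_mono_on ht₀.1 (hint t₀ ht₀)
        (Continuous.intervalIntegrable (by fun_prop) _ _) fun s hs =>
        step1 s ⟨hs.1, hs.2.trans ht₀.2⟩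
    rw [intervalIntegral.integral_add (by simp) (Continuous.intervalIntegrable (by fun_prop) _ _),
      intervalIntegral.integral_const, intervalIntegral.integral_const_mul, integral_id,
      smul_eq_mul, sub_zero] at h1
    have h2 : t₀ * K + r / (2 * T) * ((t₀ ^ 2 - 0 ^ 2) / 2) ≤
        K * T + |r| / (2 * T) * (T ^ 2 / 2) := by
      have ha : t₀ * K ≤ K * T := by nlinarith [ht₀.2]
      have hb : t₀ ^ 2 ≤ T ^ 2 := pow_le_pow_left₀ ht₀.1 ht₀.2 2
      have hc : r / (2 * T) ≤ |r| / (2 * T) := by gcongr; exact le_abs_self r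
      have hd : 0 ≤ |r| / (2 * T) := by positivity
      nlinarith [sq_nonneg t₀]
    calc r ≤ _ := h t₀ ht₀
      _ ≤ _ := by gcongr; exact h1.trans h2
  have hstep : r ≤ K + (K / 2 + |r| / 8) := by
    refine step2.trans (le_of_eq ?_)
    field_simp
    ring
  intro t ht
  refine (hQr t ht).trans ?_
  rcases le_total 0 r with h0 | h0
  · rw [abs_of_nonneg h0] at hstep; linarith
  · linarith

end Time

/-! ### Bilinearity and symmetry of the forms; lower bound for the kinetic form -/

section Linearity

variable {d : ℕ} {Ω ΓD : Set (Pt d)} {M : Mesh d Ω ΓD} {p : Fin M.nE → ℕ} (c : Coeff M.nE)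

theorem leftLinear_cellInt {V W : Type*} [AddCommGroup V] [Module ℝ V]
    {b : V → W → Fin M.nE → Pt d → ℝ} (hc : ∀ u v i, Continuous (b u v i))
    (hadd : ∀ u u' v i x, b (u + u') v i x = b u v i x + b u' v i x)
    (hsmul : ∀ (r : ℝ) u v i x, b (r • u) v i x = r * b u v i x) :
    LeftLinear fun u v => M.cellInt (b u v) := by
  refine ⟨fun u u' v => ?_, fun r u v => ?_⟩
  · simp only [Mesh.cellInt, hadd]
    rw [← Finset.sum_add_distrib]
    exact Finset.sum_congr rfl fun i _ =>
      integral_add (M.integrableOn_cell i (hc u v i)) (M.integrableOn_cell i (hc u' v i))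
  · simp only [Mesh.cellInt, hsmul, integral_const_mul, Finset.mul_sum]

theorem leftLinear_faceInt (hd : 1 ≤ d) {V W : Type*} [AddCommGroup V] [Module ℝ V]
    {b : V → W → Fin M.nF → Pt d → ℝ} (hc : ∀ u v j, Continuous (b u v j))
    (hadd : ∀ u u' v j x, b (u + u') v j x = b u v j x + b u' v j x)
    (hsmul : ∀ (r : ℝ) u v j x, b (r • u) v j x = r * b u v j x) :
    LeftLinear fun u v => M.faceInt (b u v) := by
  refine ⟨fun u u' v => ?_, fun r u v => ?_⟩
  · simp only [Mesh.faceInt, hadd]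
    rw [← Finset.sum_add_distrib]
    exact Finset.sum_congr rfl fun j _ =>
      integral_add (M.integrableOn_face hd j (hc u v j)) (M.integrableOn_face hd j (hc u' v j))
  · simp only [Mesh.faceInt, hsmul, integral_const_mul, Finset.mul_sum]

theorem Mesh.avg_add {A : Type*} [AddCommGroup A] [Module ℝ A] {τ τ₁ τ₂ : Fin M.nE → Pt d → A}
    (h : ∀ i x, τ i x = τ₁ i x + τ₂ i x) (j : Fin M.nF) (x : Pt d) :
    M.avg τ j x = M.avg τ₁ j x + M.avg τ₂ j x := by
  unfold Mesh.avg
  rcases M.minus j with _ | i'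
  · exact h _ _
  · simp only [h, smul_add]; abel

theorem Mesh.avg_smul {A : Type*} [AddCommGroup A] [Module ℝ A] {τ τ₁ : Fin M.nE → Pt d → A} {r : ℝ}
    (h : ∀ i x, τ i x = r • τ₁ i x) (j : Fin M.nF) (x : Pt d) :
    M.avg τ j x = r • M.avg τ₁ j x := by
  unfold Mesh.avg
  rcases M.minus j with _ | i'
  · exact h _ _
  · simp only [h, smul_add, smul_comm r]

theorem Mesh.jump_add (u v : Vh M p) (j : Fin M.nF) (x : Pt d) :
    M.jump (u + v).fn j x = M.jump u.fn j x + M.jump v.fn j x := by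
  unfold Mesh.jump
  rcases M.minus j with _ | i' <;>
    simp only [Vh.fn_add, WithLp.ofLp_add, Matrix.add_vecMulVec]
  abel

theorem Mesh.jump_smul (r : ℝ) (u : Vh M p) (j : Fin M.nF) (x : Pt d) :
    M.jump (r • u).fn j x = r • M.jump u.fn j x := by
  unfold Mesh.jump
  rcases M.minus j with _ | i' <;>
    simp only [Vh.fn_smul, WithLp.ofLp_smul, Matrix.smul_vecMulVec, smul_add]

theorem Mesh.jumpN_add (u v : Vh M p) (j : Fin M.nF) (x : Pt d) :
    M.jumpN (u + v).fn j x = M.jumpN u.fn j x + M.jumpN v.fn j x := by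
  unfold Mesh.jumpN
  rcases M.minus j with _ | i' <;> simp only [Vh.fn_add, inner_add_left]
  ring

theorem Mesh.jumpN_smul (r : ℝ) (u : Vh M p) (j : Fin M.nF) (x : Pt d) :
    M.jumpN (r • u).fn j x = r * M.jumpN u.fn j x := by
  unfold Mesh.jumpN
  rcases M.minus j with _ | i' <;> simp only [Vh.fn_smul, real_inner_smul_left]
  ring

theorem stress_add (u v : Vh M p) (i : Fin M.nE) (x : Pt d) :
    stress M c (u + v).fn i x = stress M c u.fn i x + stress M c v.fn i x := by
  rw [stress, Vh.fn_add, strain_add (u.differentiable_fn i) (v.differentiable_fn i), hooke_add]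
  rfl

theorem stress_smul (r : ℝ) (u : Vh M p) (i : Fin M.nE) (x : Pt d) :
    stress M c (r • u).fn i x = r • stress M c u.fn i x := by
  rw [stress, Vh.fn_smul, strain_smul r (u.differentiable_fn i), hooke_smul]
  rfl

theorem mdiv_add (u v : Vh M p) (i : Fin M.nE) (x : Pt d) :
    mdiv M c (u + v).fn i x = mdiv M c u.fn i x + mdiv M c v.fn i x := by
  rw [mdiv, Vh.fn_add, divg_add (u.differentiable_fn i) (v.differentiable_fn i), mul_add]
  rfl

theorem mdiv_smul (r : ℝ) (u : Vh M p) (i : Fin M.nE) (x : Pt d) :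
    mdiv M c (r • u).fn i x = r * mdiv M c u.fn i x := by
  rw [mdiv, Vh.fn_smul, divg_smul r (u.differentiable_fn i), mul_left_comm]
  rfl

theorem Mesh.continuous_avg_matrix {τ : Fin M.nE → Pt d → Matrix (Fin d) (Fin d) ℝ}
    (hτ : ∀ i, Continuous (τ i)) (j : Fin M.nF) : Continuous (M.avg τ j) := by
  refine continuous_matrix fun k l => ?_
  simp only [Mesh.avg_matrix_apply]
  exact M.continuous_avg (fun i => (hτ i).matrix_elem k l) j

theorem isSymmBilin_formE (hd : 1 ≤ d) (s0 : ℝ) :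
    IsSymmBilin fun u v : Vh M p => formE M p c s0 u.fn v.fn := by
  have hσ := fun u : Vh M p => continuous_stress (M := M) c u
  have hε := fun (u : Vh M p) i => continuous_strain (u.contDiff_fn i)
  have hJ := fun u : Vh M p => M.continuous_jump u.continuous_fn
  have hA := fun u : Vh M p => M.continuous_avg_matrix (hσ u)
  have h1 : LeftLinear fun u v : Vh M p =>
      M.cellInt fun i x => ddot (stress M c u.fn i x) (strain (v.fn i) x) :=
    leftLinear_cellInt (fun u v i => continuous_ddot (hσ u i) (hε v i))
      (fun u u' v i x => by rw [stress_add, ddot_add_left])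
      (fun r u v i x => by rw [stress_smul, ddot_smul_left])
  have h2 : LeftLinear fun u v : Vh M p =>
      M.faceInt fun j x => ddot (M.avg (stress M c u.fn) j x) (M.jump v.fn j x) :=
    leftLinear_faceInt hd (fun u v j => continuous_ddot (hA u j) (hJ v j))
      (fun u u' v j x => by rw [M.avg_add (stress_add c u u'), ddot_add_left])
      (fun r u v j x => by rw [M.avg_smul (stress_smul c r u), ddot_smul_left])
  have h3 : LeftLinear fun u v : Vh M p =>
      M.faceInt fun j x => ddot (M.jump u.fn j x) (M.avg (stress M c v.fn) j x) :=
    leftLinear_faceInt hd (fun u v j => continuous_ddot (hJ u j) (hA v j))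
      (fun u u' v j x => by rw [M.jump_add, ddot_add_left])
      (fun r u v j x => by rw [M.jump_smul, ddot_smul_left])
  have h4 : LeftLinear fun u v : Vh M p =>
      M.faceInt fun j x => penE M p c s0 j * ddot (M.jump u.fn j x) (M.jump v.fn j x) :=
    leftLinear_faceInt hd (fun u v j => continuous_const.mul (continuous_ddot (hJ u j) (hJ v j)))
      (fun u u' v j x => by rw [M.jump_add, ddot_add_left, mul_add])
      (fun r u v j x => by rw [M.jump_smul, ddot_smul_left, mul_left_comm])
  refine { ((h1.sub_form h2).sub_form h3).add_form h4 with symm := fun u v => ?_ }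
  have e1 : (fun i x => ddot (stress M c u.fn i x) (strain (v.fn i) x)) =
      fun i x => ddot (stress M c v.fn i x) (strain (u.fn i) x) := by
    funext i x; rw [stress, ddot_hooke_symm, ddot_comm]; rfl
  change formE M p c s0 u.fn v.fn = formE M p c s0 v.fn u.fn
  simp only [formE, e1, ddot_comm (M.jump u.fn _ _)]
  simp only [ddot_comm (M.jump v.fn _ _) (M.avg _ _ _)]
  ring

theorem isSymmBilin_formP (hd : 1 ≤ d) (m0 : ℝ) :
    IsSymmBilin fun u v : Vh M p => formP M p c m0 u.fn v.fn := by
  have hσ := fun u : Vh M p => continuous_mdiv (M := M) c u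
  have hε := fun (u : Vh M p) i => continuous_divg (u.contDiff_fn i)
  have hJ := fun u : Vh M p => M.continuous_jumpN u.continuous_fn
  have hA := fun u : Vh M p => M.continuous_avg (hσ u)
  have h1 : LeftLinear fun u v : Vh M p =>
      M.cellInt fun i x => mdiv M c u.fn i x * divg (v.fn i) x :=
    leftLinear_cellInt (fun u v i => (hσ u i).mul (hε v i))
      (fun u u' v i x => by rw [mdiv_add, add_mul])
      (fun r u v i x => by rw [mdiv_smul, mul_assoc])
  have h2 : LeftLinear fun u v : Vh M p =>
      M.faceInt fun j x => M.avg (mdiv M c u.fn) j x * M.jumpN v.fn j x :=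
    leftLinear_faceInt hd (fun u v j => (hA u j).mul (hJ v j))
      (fun u u' v j x => by rw [M.avg_add (mdiv_add c u u'), add_mul])
      (fun r u v j x => by rw [M.avg_smul (mdiv_smul c r u), smul_eq_mul, mul_assoc])
  have h3 : LeftLinear fun u v : Vh M p =>
      M.faceInt fun j x => M.jumpN u.fn j x * M.avg (mdiv M c v.fn) j x :=
    leftLinear_faceInt hd (fun u v j => (hJ u j).mul (hA v j))
      (fun u u' v j x => by rw [M.jumpN_add, add_mul])
      (fun r u v j x => by rw [M.jumpN_smul, mul_assoc])
  have h4 : LeftLinear fun u v : Vh M p =>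
      M.faceInt fun j x => penP M p c m0 j * (M.jumpN u.fn j x * M.jumpN v.fn j x) :=
    leftLinear_faceInt hd (fun u v j => continuous_const.mul ((hJ u j).mul (hJ v j)))
      (fun u u' v j x => by rw [M.jumpN_add]; ring)
      (fun r u v j x => by rw [M.jumpN_smul]; ring)
  refine { ((h1.sub_form h2).sub_form h3).add_form h4 with symm := fun u v => ?_ }
  have e1 : (fun i x => mdiv M c u.fn i x * divg (v.fn i) x) =
      fun i x => mdiv M c v.fn i x * divg (u.fn i) x := by
    funext i x; simp only [mdiv]; ring
  change formP M p c m0 u.fn v.fn = formP M p c m0 v.fn u.fn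
  simp only [formP, e1, mul_comm (M.jumpN u.fn _ _)]
  simp only [mul_comm (M.jumpN v.fn _ _) (M.avg _ _ _)]
  ring

theorem Vh.continuous_inner_comb (a b : ℝ) (u v w : Vh M p) (i : Fin M.nE) :
    Continuous fun x => inner ℝ (a • u.fn i x + b • v.fn i x) (w.fn i x) := by
  have hu := u.continuous_fn i
  have hv := v.continuous_fn i
  have hw := w.continuous_fn i
  fun_prop

/-- Symmetry rests on the two coupling coefficients both being ρ_f. The form is viewed on pairs, so
that (∂ₜu, ∂ₜw) is a single curve to which the quadratic calculus applies. -/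
theorem isSymmBilin_formM :
    IsSymmBilin fun q r : Vh M p × Vh M p => formM M c q.1.fn q.2.fn r.1.fn r.2.fn := by
  have h1 : LeftLinear fun q r : Vh M p × Vh M p => M.cellInt fun i x =>
      inner ℝ (c.rho i • q.1.fn i x + c.rhof i • q.2.fn i x) (r.1.fn i x) :=
    leftLinear_cellInt
      (fun q r i => Vh.continuous_inner_comb _ _ q.1 q.2 r.1 i)
      (fun q q' r i x => by
        simp only [Prod.fst_add, Prod.snd_add, Vh.fn_add, smul_add, inner_add_left]; ring)
      (fun a q r i x => by
        simp only [Prod.smul_fst, Prod.smul_snd, Vh.fn_smul, inner_add_left,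
          real_inner_smul_left]; ring)
  have h2 : LeftLinear fun q r : Vh M p × Vh M p => M.cellInt fun i x =>
      inner ℝ (c.rhof i • q.1.fn i x + c.rhow i • q.2.fn i x) (r.2.fn i x) :=
    leftLinear_cellInt
      (fun q r i => Vh.continuous_inner_comb _ _ q.1 q.2 r.2 i)
      (fun q q' r i x => by
        simp only [Prod.fst_add, Prod.snd_add, Vh.fn_add, smul_add, inner_add_left]; ring)
      (fun a q r i x => by
        simp only [Prod.smul_fst, Prod.smul_snd, Vh.fn_smul, inner_add_left,
          real_inner_smul_left]; ring)
  refine { h1.add_form h2 with symm := fun q r => ?_ }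
  simp only [formM, Mesh.cellInt, ← Finset.sum_add_distrib]
  refine Finset.sum_congr rfl fun i _ => ?_
  have hint : ∀ (a b : ℝ) (u v w : Vh M p), IntegrableOn
      (fun x => inner ℝ (a • u.fn i x + b • v.fn i x) (w.fn i x)) (M.cell i) := fun a b u v w =>
    M.integrableOn_cell i (Vh.continuous_inner_comb a b u v w i)
  rw [← integral_add (hint _ _ _ _ _) (hint _ _ _ _ _),
    ← integral_add (hint _ _ _ _ _) (hint _ _ _ _ _)]
  congr 1
  funext x
  simp only [inner_add_left, real_inner_smul_left]
  rw [real_inner_comm (q.1.fn i x) (r.1.fn i x), real_inner_comm (q.1.fn i x) (r.2.fn i x),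
    real_inner_comm (q.2.fn i x) (r.1.fn i x), real_inner_comm (q.2.fn i x) (r.2.fn i x)]
  ring

theorem isSymmBilin_wip (q : Fin M.nE → ℝ) :
    IsSymmBilin fun u v : Vh M p => wip M q u.fn v.fn := by
  have h1 : LeftLinear fun u v : Vh M p => M.cellInt fun i x =>
      q i * inner ℝ (u.fn i x) (v.fn i x) :=
    leftLinear_cellInt
      (fun u v i => continuous_const.mul ((u.continuous_fn i).inner (v.continuous_fn i)))
      (fun u u' v i x => by simp only [Vh.fn_add, inner_add_left]; ring)
      (fun a u v i x => by simp only [Vh.fn_smul, real_inner_smul_left]; ring)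
  refine { h1 with symm := fun u v => ?_ }
  simp only [wip, real_inner_comm (u.fn _ _)]

theorem wip_self (q : Fin M.nE → ℝ) (v : Fin M.nE → Pt d → Pt d) : wip M q v v = wsq M q v := by
  simp only [wip, wsq, real_inner_self_eq_norm_sq]

theorem wsq_nonneg {q : Fin M.nE → ℝ} (hq : ∀ i, 0 ≤ q i) (v : Fin M.nE → Pt d → Pt d) :
    0 ≤ wsq M q v :=
  M.cellInt_nonneg fun i _ => mul_nonneg (hq i) (sq_nonneg _)

theorem wsq_const_mul (r : ℝ) (q : Fin M.nE → ℝ) (v : Fin M.nE → Pt d → Pt d) :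
    wsq M (fun i => r * q i) v = r * wsq M q v := by
  simp only [wsq, Mesh.cellInt, mul_assoc, integral_const_mul, Finset.mul_sum]

/-- Elementwise multiplication by constants as a linear map. -/
def cmulLinear (β : Fin M.nE → ℝ) : Vh M p →ₗ[ℝ] Vh M p where
  toFun := cmul β
  map_add' u v := by funext i; simp [cmul]
  map_smul' r u := by funext i; simp [cmul, smul_comm r]

/-- The map `(u, w) ↦ β u + w`. -/
def pressureField (β : Fin M.nE → ℝ) : Vh M p × Vh M p →ₗ[ℝ] Vh M p :=
  (cmulLinear β).comp (LinearMap.fst ℝ _ _) + LinearMap.snd ℝ _ _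

theorem pressureField_apply (β : Fin M.nE → ℝ) (q : Vh M p × Vh M p) :
    pressureField β q = cmul β q.1 + q.2 := rfl

/-- The pressure form is pulled back along the linear map (u, w) ↦ β u + w in both slots, which
preserves symmetry. -/
theorem isSymmBilin_stiffness (hd : 1 ≤ d) (s0 m0 : ℝ) :
    IsSymmBilin fun q r : Vh M p × Vh M p => formE M p c s0 q.1.fn r.1.fn +
      formP M p c m0 (Vh.fn (cmul c.beta q.1 + q.2)) (Vh.fn (cmul c.beta r.1 + r.2)) := by
  have h1 := (isSymmBilin_formE (M := M) (p := p) c hd s0).comp (LinearMap.fst ℝ (Vh M p) (Vh M p))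
  have h2 := (isSymmBilin_formP (M := M) (p := p) c hd m0).comp (pressureField c.beta)
  simp only [pressureField_apply] at h2
  simp only [LinearMap.fst_apply] at h1
  exact h1.add_form h2

/-- Since ρ = φρ_f + 2ρ_u, the terms φρ_f|x|² + 2ρ_f x·y + φ⁻¹ρ_f|y|² form the square φρ_f|x +
φ⁻¹y|², and what is left is 2ρ_u|x|² + (a − 1)φ⁻¹ρ_f|y|². The tortuosity a > 1 makes the last term
nonnegative. -/
theorem Coeff.kinetic_le {n : ℕ} (c : Coeff n) (i : Fin n) (x y : Pt d) :
    2 * (c.rhou i * ‖x‖ ^ 2) + c.rhof i * c.phi i * ‖x + (c.phi i)⁻¹ • y‖ ^ 2 ≤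
      inner ℝ (c.rho i • x + c.rhof i • y) x + inner ℝ (c.rhof i • x + c.rhow i • y) y := by
  rw [norm_add_sq_real, norm_smul, mul_pow, Real.norm_eq_abs, sq_abs, real_inner_smul_right,
    inner_add_left, inner_add_left, real_inner_smul_left, real_inner_smul_left,
    real_inner_smul_left, real_inner_smul_left, real_inner_self_eq_norm_sq,
    real_inner_self_eq_norm_sq, real_inner_comm x y]
  have hφ := c.phi_pos i
  have h0 : 0 ≤ (c.a i - 1) * (c.phi i)⁻¹ * c.rhof i * ‖y‖ ^ 2 :=
    mul_nonneg (mul_nonneg (mul_nonneg (sub_nonneg.2 (c.one_lt_a i).le) (inv_nonneg.2 hφ.le))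
      (c.rhof_pos i).le) (sq_nonneg _)
  have hφi : c.phi i * (c.phi i)⁻¹ = 1 := mul_inv_cancel₀ hφ.ne'
  rw [Coeff.rho, Coeff.rhow, Coeff.rhou, ← sub_nonneg]
  refine h0.trans (le_of_eq ?_)
  set r := (c.phi i)⁻¹
  linear_combination (2 * c.rhof i * inner ℝ x y + c.rhof i * r * ‖y‖ ^ 2) * hφi

theorem wsq_add_wsq_le_formM (u w : Vh M p) :
    2 * wsq M c.rhou u.fn + wsq M (fun i => c.rhof i * c.phi i)
        (Vh.fn (u + cmul (fun i => (c.phi i)⁻¹) w)) ≤ formM M c u.fn w.fn u.fn w.fn := by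
  set z : Vh M p := u + cmul (fun i => (c.phi i)⁻¹) w with hz
  have hzfn : ∀ i x, z.fn i x = u.fn i x + (c.phi i)⁻¹ • w.fn i x := fun i x => by
    rw [hz, Vh.fn_add, fn_cmul]
  have hint : ∀ (a b : ℝ) (v : Vh M p) (i), IntegrableOn
      (fun x => inner ℝ (a • u.fn i x + b • w.fn i x) (v.fn i x)) (M.cell i) := fun a b v i =>
    M.integrableOn_cell i (Vh.continuous_inner_comb a b u w v i)
  have hsq : ∀ (a : ℝ) (v : Vh M p) (i), IntegrableOn (fun x => a * ‖v.fn i x‖ ^ 2) (M.cell i) :=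
    fun a v i => M.integrableOn_cell i (continuous_const.mul ((v.continuous_fn i).norm.pow 2))
  rw [wsq, wsq, formM, Mesh.cellInt, Mesh.cellInt, Mesh.cellInt, Mesh.cellInt, Finset.mul_sum,
    ← Finset.sum_add_distrib, ← Finset.sum_add_distrib]
  refine Finset.sum_le_sum fun i _ => ?_
  rw [← integral_add (hint _ _ u i) (hint _ _ w i), ← integral_const_mul,
    ← integral_add ((hsq _ u i).const_mul _) (hsq _ z i)]
  refine integral_mono (((hsq _ u i).const_mul _).add (hsq _ z i))
    ((hint _ _ u i).add (hint _ _ w i)) fun x => ?_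
  simp only [hzfn]
  exact c.kinetic_le i _ _

end Linearity

/-! ### The source terms in space and time -/

section Sources

variable {d : ℕ} {Ω ΓD : Set (Pt d)} {M : Mesh d Ω ΓD} {p : Fin M.nE → ℕ}

theorem memLp_cell (hΩ : IsPolytope Ω) (f : Lp (Pt d) 2 (volume.restrict Ω)) (i : Fin M.nE) :
    MemLp f 2 (volume.restrict (M.cell i)) :=
  (Lp.memLp f).mono_measure (Measure.restrict_mono (M.cell_subset hΩ i) le_rfl)

theorem integrableOn_norm_sq (hΩ : IsPolytope Ω) (f : Lp (Pt d) 2 (volume.restrict Ω))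
    (i : Fin M.nE) : IntegrableOn (fun x => ‖f x‖ ^ 2) (M.cell i) :=
  (memLp_two_iff_integrable_sq_norm (memLp_cell hΩ f i).1).1 (memLp_cell hΩ f i)

theorem integrableOn_inner (hΩ : IsPolytope Ω) (f : Lp (Pt d) 2 (volume.restrict Ω)) (v : Vh M p)
    (i : Fin M.nE) : IntegrableOn (fun x => inner ℝ (f x) (v.fn i x)) (M.cell i) := by
  have hv : IntegrableOn (fun x => ‖v.fn i x‖ ^ 2) (M.cell i) :=
    M.integrableOn_cell i ((v.continuous_fn i).norm.pow 2)
  refine ((integrableOn_norm_sq hΩ f i).add hv).mono'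
    ((memLp_cell hΩ f i).1.inner (v.continuous_fn i).aestronglyMeasurable)
    (ae_of_all _ fun x => ?_)
  refine (norm_inner_le_norm _ _).trans ?_
  simp only [Pi.add_apply]
  nlinarith [sq_nonneg (‖f x‖ - ‖v.fn i x‖), sq_nonneg ‖f x‖, sq_nonneg ‖v.fn i x‖]

/-- Weighted Young inequality for the work of a source. -/
theorem two_mul_cellInt_inner_le (hΩ : IsPolytope Ω) (f : Lp (Pt d) 2 (volume.restrict Ω))
    (v : Vh M p) {q : Fin M.nE → ℝ} (hq : ∀ i, 0 < q i) :
    2 * M.cellInt (fun i x => inner ℝ (f x) (v.fn i x)) ≤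
      wsq M (fun i => (q i)⁻¹) (fun _ x => f x) + wsq M q v.fn := by
  rw [Mesh.cellInt, wsq, wsq, Mesh.cellInt, Mesh.cellInt, Finset.mul_sum, ← Finset.sum_add_distrib]
  refine Finset.sum_le_sum fun i _ => ?_
  have h1 := (integrableOn_norm_sq hΩ f i).const_mul (q i)⁻¹
  have h2 : IntegrableOn (fun x => q i * ‖v.fn i x‖ ^ 2) (M.cell i) :=
    M.integrableOn_cell i (continuous_const.mul ((v.continuous_fn i).norm.pow 2))
  rw [← integral_const_mul, ← integral_add h1 h2]
  refine integral_mono ((integrableOn_inner hΩ f v i).const_mul _) (h1.add h2) fun x => ?_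
  have hi := real_inner_le_norm (f x) (v.fn i x)
  have h3 : 0 ≤ (q i)⁻¹ * (‖f x‖ - q i * ‖v.fn i x‖) ^ 2 :=
    mul_nonneg (inv_nonneg.2 (hq i).le) (sq_nonneg _)
  have h4 : (q i)⁻¹ * (‖f x‖ - q i * ‖v.fn i x‖) ^ 2 =
      (q i)⁻¹ * ‖f x‖ ^ 2 - 2 * (‖f x‖ * ‖v.fn i x‖) + q i * ‖v.fn i x‖ ^ 2 := by
    have := (hq i).ne'
    field_simp
    ring
  simp only
  linarith

/-- Expresses the cellwise integral through a continuous linear restriction map on L², so that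
measurability and integrability in time pass from the L²-valued source to its local norms. -/
theorem setIntegral_norm_sq_eq (hΩ : IsPolytope Ω) (f : Lp (Pt d) 2 (volume.restrict Ω))
    (i : Fin M.nE) : ∫ x in M.cell i, ‖f x‖ ^ 2 =
      ‖LpToLpRestrictCLM (Pt d) (Pt d) ℝ (volume.restrict Ω) 2 (M.cell i) f‖ ^ 2 := by
  have hμ : (volume.restrict Ω).restrict (M.cell i) = volume.restrict (M.cell i) :=
    Measure.restrict_restrict_of_subset (M.cell_subset hΩ i)
  rw [← real_inner_self_eq_norm_sq, L2.inner_def, ← hμ]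
  refine integral_congr_ae ?_
  filter_upwards [LpToLpRestrictCLM_coeFn ℝ (M.cell i) f] with x hx
  rw [hx, real_inner_self_eq_norm_sq]

theorem intervalIntegrable_wsq_source (hΩ : IsPolytope Ω) {T : ℝ} (hT : 0 ≤ T)
    {f : ℝ → Lp (Pt d) 2 (volume.restrict Ω)} (hf : MemLp f 2 (volume.restrict (Ioc 0 T)))
    (q : Fin M.nE → ℝ) :
    IntervalIntegrable (fun s => wsq M q (fun _ x => f s x)) volume 0 T := by
  rw [intervalIntegrable_iff_integrableOn_Ioc_of_le hT]
  simp only [wsq, Mesh.cellInt, integral_const_mul, setIntegral_norm_sq_eq hΩ]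
  refine integrable_finsetSum _ fun i _ => Integrable.const_mul ?_ _
  have h := (LpToLpRestrictCLM (Pt d) (Pt d) ℝ (volume.restrict Ω) 2 (M.cell i)).comp_memLp' hf
  exact (memLp_two_iff_integrable_sq_norm h.1).1 h

end Sources

/-! ### Energy identity and integrated energy inequality -/

section Energy

variable {d : ℕ} {Ω ΓD : Set (Pt d)} {M : Mesh d Ω ΓD} {p : Fin M.nE → ℕ} {c : Coeff M.nE}

theorem continuousOn_primitive {V : Type*} [NormedAddCommGroup V] [NormedSpace ℝ V]
    {T : ℝ} (hT : 0 ≤ T) {U U' : ℝ → V} {U₀ : V} (hU' : IntervalIntegrable U' volume 0 T)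
    (hU : ∀ t ∈ Icc 0 T, U t = U₀ + ∫ s in (0 : ℝ)..t, U' s) : ContinuousOn U (Icc 0 T) := by
  have h := intervalIntegral.continuousOn_primitive_interval' hU' left_mem_uIcc
  rw [uIcc_of_le hT] at h
  exact ((continuousOn_const (c := U₀)).fun_add h).congr hU

theorem eq_add_integral_of_hasDerivWithinAt {V : Type*} [NormedAddCommGroup V] [NormedSpace ℝ V]
    [CompleteSpace V] {T : ℝ} {U U' : ℝ → V} {U₀ : V} (h0 : U 0 = U₀)
    (hc : ContinuousOn U' (Icc 0 T))
    (hU : ∀ t ∈ Icc 0 T, HasDerivWithinAt U (U' t) (Icc 0 T) t) :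
    ∀ t ∈ Icc 0 T, U t = U₀ + ∫ s in (0 : ℝ)..t, U' s := by
  intro t ht
  have hsub : Icc 0 t ⊆ Icc 0 T := Icc_subset_Icc_right ht.2
  rw [intervalIntegral.integral_eq_sub_of_hasDerivAt_of_le ht.1 (f := U)
    (fun s hs => ((hU s (hsub hs)).continuousWithinAt).mono hsub)
    (fun s hs => (hU s (hsub (Ioo_subset_Icc_self hs))).hasDerivAt
      (Icc_mem_nhds hs.1 (hs.2.trans_le ht.2)))
    ((hc.mono (by rwa [uIcc_of_le ht.1])).intervalIntegrable), h0, add_sub_cancel]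

/-- The forms couple u and w, so the two curves are joined into one with values in the product
space. -/
theorem eq_add_integral_prod {V : Type*} [NormedAddCommGroup V] [NormedSpace ℝ V]
    [CompleteSpace V] {T : ℝ} (hT : 0 ≤ T) {U W U' W' : ℝ → V} {U₀ W₀ : V}
    (hU' : IntervalIntegrable U' volume 0 T) (hW' : IntervalIntegrable W' volume 0 T)
    (hU : ∀ t ∈ Icc 0 T, U t = U₀ + ∫ s in (0 : ℝ)..t, U' s)
    (hW : ∀ t ∈ Icc 0 T, W t = W₀ + ∫ s in (0 : ℝ)..t, W' s) :
    IntervalIntegrable (fun s => (U' s, W' s)) volume 0 T ∧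
      ∀ t ∈ Icc 0 T, (U t, W t) = (U₀, W₀) + ∫ s in (0 : ℝ)..t, (U' s, W' s) := by
  refine ⟨⟨hU'.1.prodMk hW'.1, hU'.2.prodMk hW'.2⟩, fun t ht => ?_⟩
  have hsub : uIcc 0 t ⊆ uIcc 0 T := by
    rw [uIcc_of_le hT, uIcc_of_le ht.1]; exact Icc_subset_Icc_right ht.2
  have h : ∫ s in (0 : ℝ)..t, (U' s, W' s) =
      (∫ s in (0 : ℝ)..t, U' s, ∫ s in (0 : ℝ)..t, W' s) := by
    simp only [intervalIntegral.integral_of_le ht.1]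
    exact integral_pair (hU'.mono_set hsub).1 (hW'.mono_set hsub).1
  rw [h, hU t ht, hW t ht]
  rfl

theorem continuousOn_wsq (q : Fin M.nE → ℝ) {T : ℝ} {U : ℝ → Vh M p}
    (hU : ContinuousOn U (Icc 0 T)) : ContinuousOn (fun s => wsq M q (U s).fn) (Icc 0 T) := by
  have h := (isSymmBilin_wip (M := M) (p := p) q).continuous.comp_continuousOn (hU.prodMk hU)
  refine h.congr fun s _ => ?_
  exact (wip_self q _).symm

variable {s0 m0 T : ℝ} {f g : ℝ → Lp (Pt d) 2 (volume.restrict Ω)} {u0 w0 u1 w1 : Vh M p}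
  {u w ut wt utt wtt : ℝ → Vh M p}

/-- The mechanical energy of the semi-discrete problem. -/
def mechEnergy (c : Coeff M.nE) (s0 m0 : ℝ) (u w ut wt : Vh M p) : ℝ :=
  formM M c ut.fn wt.fn ut.fn wt.fn + (formE M p c s0 u.fn u.fn +
    formP M p c m0 (Vh.fn (cmul c.beta u + w)) (Vh.fn (cmul c.beta u + w)))

/-- Coercivity of the mechanical energy. -/
theorem le_mechEnergy {C : ℝ} (hM : M.PolytopicRegular C) (hd : 1 ≤ d) (hC : 0 < C)
    (hp : ∀ i, 1 ≤ p i) (hs : 64 * (64 * 2 ^ (d - 1) * C) ≤ s0)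
    (hm : 64 * (64 * 2 ^ (d - 1) * C) ≤ m0) (u w ut wt : Vh M p) :
    2 * wsq M c.rhou ut.fn + wsq M (fun i => c.rhof i * c.phi i)
        (Vh.fn (ut + cmul (fun i => (c.phi i)⁻¹) wt)) + 7 / 8 * (dgESq M p c s0 u.fn +
        dgPSq M p c m0 (Vh.fn (cmul c.beta u + w))) ≤ mechEnergy c s0 m0 u w ut wt := by
  have h1 := wsq_add_wsq_le_formM c ut wt
  have h2 := dgESq_le_formE c hM hd hC hp hs u
  have h3 := dgPSq_le_formP c hM hd hC hp hm (cmul c.beta u + w)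
  rw [mechEnergy]
  linarith

namespace IsSemidiscreteSolution

variable (hS : IsSemidiscreteSolution c s0 m0 T f g u0 w0 u1 w1 u w ut wt utt wtt)
include hS

theorem continuousOn_ut (hT : 0 ≤ T) : ContinuousOn ut (Icc 0 T) :=
  continuousOn_primitive hT hS.int_utt hS.ut_eq

theorem continuousOn_wt (hT : 0 ≤ T) : ContinuousOn wt (Icc 0 T) :=
  continuousOn_primitive hT hS.int_wtt hS.wt_eq

/-- The mechanical energy is absolutely continuous, and its derivative is the power of the sources
minus the dissipation. -/
theorem mechEnergy_eq (hd : 1 ≤ d) (hT : 0 ≤ T) :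
    ∃ N' : ℝ → ℝ, IntervalIntegrable N' volume 0 T ∧
      (∀ t ∈ Icc 0 T, mechEnergy c s0 m0 (u t) (w t) (ut t) (wt t) =
        mechEnergy c s0 m0 u0 w0 u1 w1 + ∫ s in (0 : ℝ)..t, N' s) ∧
      ∀ᵐ s ∂(volume.restrict (Ioc 0 T)), N' s =
        2 * (M.cellInt (fun i x => inner ℝ (f s x) ((ut s).fn i x))
          + M.cellInt (fun i x => inner ℝ (g s x) ((wt s).fn i x))
          - wsq M (fun i => c.eta i / c.k i) (wt s).fn) := by
  have hcu := hS.continuousOn_ut hT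
  have hcw := hS.continuousOn_wt hT
  have hu := eq_add_integral_of_hasDerivWithinAt hS.init_u hcu hS.deriv_u
  have hw := eq_add_integral_of_hasDerivWithinAt hS.init_w hcw hS.deriv_w
  have hIcc : uIcc 0 T = Icc 0 T := uIcc_of_le hT
  obtain ⟨i1, e1⟩ := eq_add_integral_prod hT hS.int_utt hS.int_wtt hS.ut_eq hS.wt_eq
  obtain ⟨i2, e2⟩ := eq_add_integral_prod hT
    (hcu.mono hIcc.subset).intervalIntegrable (hcw.mono hIcc.subset).intervalIntegrable hu hw
  have hBM := isSymmBilin_formM (M := M) (p := p) c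
  have hBA := isSymmBilin_stiffness (M := M) (p := p) c hd s0 m0
  obtain ⟨j1, k1⟩ := hBM.self_eq_add_integral hT i1 e1
  obtain ⟨j2, k2⟩ := hBA.self_eq_add_integral hT i2 e2
  refine ⟨_, j1.add j2, fun t ht => ?_, ?_⟩
  · have hsub : uIcc 0 t ⊆ uIcc 0 T := by
      rw [hIcc, uIcc_of_le ht.1]; exact Icc_subset_Icc_right ht.2
    have hadd := intervalIntegral.integral_add (j1.mono_set hsub) (j2.mono_set hsub)
    have h1 := k1 t ht
    have h2 := k2 t ht
    simp only
    rw [hadd, mechEnergy, mechEnergy, h1, h2]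
    ring
  · filter_upwards [hS.equation] with s hs
    -- The discrete velocities are admissible test functions; the terms of the equation then become
    -- the halves of the time derivatives of the two quadratic forms.
    have h := hs (ut s) (wt s)
    have hsymm := hBA.symm (ut s, wt s) (u s, w s)
    rw [wip_self] at h
    simp only at hsymm ⊢
    rw [hsymm]
    linarith

/-- Integrated energy inequality. -/
theorem mechEnergy_add_le (hΩ : IsPolytope Ω) (hd : 1 ≤ d) (hT : 0 < T)
    (hf : MemLp f 2 (volume.restrict (Ioc 0 T))) (hg : MemLp g 2 (volume.restrict (Ioc 0 T)))
    {t : ℝ} (ht : t ∈ Icc 0 T) :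
    mechEnergy c s0 m0 (u t) (w t) (ut t) (wt t) +
        ∫ s in (0 : ℝ)..t, wsq M (fun i => c.eta i / c.k i) (wt s).fn ≤
      mechEnergy c s0 m0 u0 w0 u1 w1
        + (∫ s in (0 : ℝ)..T, wsq M (fun i => c.k i / c.eta i) (fun _ x => g s x))
        + T * (∫ s in (0 : ℝ)..T, wsq M (fun i => (c.rhou i)⁻¹) (fun _ x => f s x))
        + 1 / T * ∫ s in (0 : ℝ)..t, wsq M c.rhou (ut s).fn := by
  obtain ⟨N', hN', hN, hae⟩ := hS.mechEnergy_eq hd hT.le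
  set D : ℝ → ℝ := fun s => wsq M (fun i => c.eta i / c.k i) (wt s).fn with hD
  set R : ℝ → ℝ := fun s => wsq M c.rhou (ut s).fn with hR
  set G : ℝ → ℝ := fun s => wsq M (fun i => c.k i / c.eta i) (fun _ x => g s x) with hG
  set F : ℝ → ℝ := fun s => wsq M (fun i => (c.rhou i)⁻¹) (fun _ x => f s x) with hF
  have hrhou : ∀ i, 0 < c.rhou i := fun i => by
    have := c.phi_lt_one i
    have := mul_pos (c.rhos_pos i) (sub_pos.2 this)
    rw [Coeff.rhou]; linarith
  have hsub : uIcc 0 t ⊆ uIcc 0 T := by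
    rw [uIcc_of_le hT.le, uIcc_of_le ht.1]; exact Icc_subset_Icc_right ht.2
  have hsubI : uIcc 0 t ⊆ Icc 0 T := by rwa [uIcc_of_le hT.le] at hsub
  have iD : IntervalIntegrable D volume 0 t :=
    ((continuousOn_wsq _ (hS.continuousOn_wt hT.le)).mono hsubI).intervalIntegrable
  have iR : IntervalIntegrable R volume 0 t :=
    ((continuousOn_wsq _ (hS.continuousOn_ut hT.le)).mono hsubI).intervalIntegrable
  have iG := intervalIntegrable_wsq_source (M := M) hΩ hT.le hg (fun i => c.k i / c.eta i)
  have iF := intervalIntegrable_wsq_source (M := M) hΩ hT.le hf (fun i => (c.rhou i)⁻¹)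
  have iGt := iG.mono_set hsub
  have iFt := iF.mono_set hsub
  have hG0 : ∀ s, 0 ≤ G s := fun s =>
    wsq_nonneg (fun i => (div_pos (c.k_pos i) (c.eta_pos i)).le) _
  have hF0 : ∀ s, 0 ≤ F s := fun s => wsq_nonneg (fun i => (inv_pos.2 (hrhou i)).le) _
  have hpt : ∀ᵐ s ∂(volume.restrict (Icc 0 t)), N' s ≤ G s + T * F s + 1 / T * R s - D s := by
    rw [← Measure.restrict_congr_set (Ioc_ae_eq_Icc (a := (0 : ℝ)) (b := t))]
    filter_upwards [ae_restrict_of_ae_restrict_of_subset (Ioc_subset_Ioc_right ht.2) hae] with s hs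
    -- With the weight η/k the source g uses up exactly one of the two copies of the dissipation.
    have y1 := two_mul_cellInt_inner_le hΩ (g s) (wt s)
      (q := fun i => c.eta i / c.k i) fun i => div_pos (c.eta_pos i) (c.k_pos i)
    -- The weight ρ_u/T yields the factor T in front of f and the Gronwall coefficient 1/T in front
    -- of the kinetic term.
    have y2 := two_mul_cellInt_inner_le hΩ (f s) (ut s)
      (q := fun i => 1 / T * c.rhou i) fun i => mul_pos (by positivity) (hrhou i)
    simp only [inv_div] at y1
    simp only [mul_inv, one_div, inv_inv] at y2
    rw [wsq_const_mul, wsq_const_mul] at y2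
    rw [hs]
    simp only [one_div]
    linarith
  have hmono := intervalIntegral.integral_mono_ae_restrict ht.1 (hN'.mono_set hsub)
    (((iGt.add (iFt.const_mul T)).add (iR.const_mul (1 / T))).sub iD) hpt
  have hsplit : ∫ s in (0 : ℝ)..t, (G s + T * F s + 1 / T * R s - D s) =
      (∫ s in (0 : ℝ)..t, G s) + T * (∫ s in (0 : ℝ)..t, F s) +
        1 / T * (∫ s in (0 : ℝ)..t, R s) - ∫ s in (0 : ℝ)..t, D s := by
    rw [intervalIntegral.integral_sub ((iGt.add (iFt.const_mul T)).add (iR.const_mul (1 / T))) iD,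
      intervalIntegral.integral_add (iGt.add (iFt.const_mul T)) (iR.const_mul (1 / T)),
      intervalIntegral.integral_add iGt (iFt.const_mul T), intervalIntegral.integral_const_mul,
      intervalIntegral.integral_const_mul]
  have hle := hmono.trans hsplit.le
  have hGT : ∫ s in (0 : ℝ)..t, G s ≤ ∫ s in (0 : ℝ)..T, G s :=
    intervalIntegral.integral_mono_interval le_rfl ht.1 ht.2 (ae_of_all _ hG0) iG
  have hFT : ∫ s in (0 : ℝ)..t, F s ≤ ∫ s in (0 : ℝ)..T, F s :=
    intervalIntegral.integral_mono_interval le_rfl ht.1 ht.2 (ae_of_all _ hF0) iF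
  have hFT' := mul_le_mul_of_nonneg_left hFT hT.le
  rw [hN t ht]
  linarith

end IsSemidiscreteSolution

end Energy

end PolyDG

end

/-! ### The stability estimate -/

theorem proposition5p1 (d : ℕ) (hd : d = 2 ∨ d = 3) (Creg : ℝ) (hCreg : 0 < Creg) :
    ∃ sStar mStar : ℝ, 0 < sStar ∧ 0 < mStar ∧
      ∀ (Ω ΓD : Set (PolyDG.Pt d)), PolyDG.IsPolytope Ω → ΓD ⊆ frontier Ω →
      ∀ (M : PolyDG.Mesh d Ω ΓD), M.PolytopicRegular Creg →
      ∀ (p : Fin M.nE → ℕ), (∀ i, 1 ≤ p i) →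
      ∀ (c : PolyDG.Coeff M.nE) (s0 m0 : ℝ), sStar ≤ s0 → mStar ≤ m0 →
      ∀ (T : ℝ), 0 < T →
      ∀ (f g : ℝ → Lp (PolyDG.Pt d) 2 (volume.restrict Ω)),
        MemLp f 2 (volume.restrict (Ioc 0 T)) → MemLp g 2 (volume.restrict (Ioc 0 T)) →
      ∀ (u0 w0 u1 w1 : PolyDG.Vh M p) (u w ut wt utt wtt : ℝ → PolyDG.Vh M p),
        PolyDG.IsSemidiscreteSolution c s0 m0 T f g u0 w0 u1 w1 u w ut wt utt wtt →
      ∀ t ∈ Icc 0 T,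
        PolyDG.energySq c s0 m0 u w ut wt t ≤
          2 * ((∫ s in (0 : ℝ)..T, PolyDG.wsq M (fun i => c.k i / c.eta i) (fun _ x => g s x))
            + T * (∫ s in (0 : ℝ)..T, PolyDG.wsq M (fun i => (c.rhou i)⁻¹) (fun _ x => f s x))
            + PolyDG.initialEnergy c s0 m0 u0 w0 u1 w1) := by
  have hd1 : 1 ≤ d := by omega
  have hK : 0 < 64 * (64 * 2 ^ (d - 1) * Creg) := by positivity
  -- The inner factor 64 · 2^(d-1) · Creg is the constant of the inverse trace inequality; the outer
  -- 64 is (1/8)⁻², one factor 8 from Young's weight and one from the share of the cell term that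
  -- may be lost.
  refine ⟨64 * (64 * 2 ^ (d - 1) * Creg), 64 * (64 * 2 ^ (d - 1) * Creg), hK, hK, ?_⟩
  intro Ω ΓD hΩ _ M hM p hp c s0 m0 hs hm T hT f g hf hg u0 w0 u1 w1 u w ut wt utt wtt hS
  have hrhou : ∀ i, 0 ≤ c.rhou i := fun i => by
    have := mul_pos (c.rhos_pos i) (sub_pos.2 (c.phi_lt_one i))
    rw [PolyDG.Coeff.rhou]; linarith
  have hcoer := fun a b a' b' : PolyDG.Vh M p =>
    PolyDG.le_mechEnergy (c := c) hM hd1 hCreg hp hs hm a b a' b'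
  have hdgE := PolyDG.dgESq_nonneg (M := M) (p := p) c hd1 (hK.le.trans hs)
  have hdgP := PolyDG.dgPSq_nonneg (M := M) (p := p) c hd1 (hK.le.trans hm)
  have hkin : ∀ v : PolyDG.Vh M p, 0 ≤ PolyDG.wsq M c.rhou v.fn := fun v =>
    PolyDG.wsq_nonneg hrhou _
  have hmix : ∀ v : PolyDG.Vh M p, 0 ≤ PolyDG.wsq M (fun i => c.rhof i * c.phi i) v.fn := fun v =>
    PolyDG.wsq_nonneg (fun i => (mul_pos (c.rhof_pos i) (c.phi_pos i)).le) _
  have hdiss : ∀ v : PolyDG.Vh M p, 0 ≤ PolyDG.wsq M (fun i => c.eta i / c.k i) v.fn := fun v =>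
    PolyDG.wsq_nonneg (fun i => (div_pos (c.eta_pos i) (c.k_pos i)).le) _
  set D : ℝ → ℝ := fun s => PolyDG.wsq M (fun i => c.eta i / c.k i) (wt s).fn with hD
  set Q : ℝ → ℝ := fun t =>
    PolyDG.mechEnergy c s0 m0 (u t) (w t) (ut t) (wt t) + ∫ s in (0 : ℝ)..t, D s with hQ
  set K : ℝ := PolyDG.mechEnergy c s0 m0 u0 w0 u1 w1
    + (∫ s in (0 : ℝ)..T, PolyDG.wsq M (fun i => c.k i / c.eta i) (fun _ x => g s x))
    + T * (∫ s in (0 : ℝ)..T, PolyDG.wsq M (fun i => (c.rhou i)⁻¹) (fun _ x => f s x)) with hKdef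
  -- Coercivity at the initial data makes the initial energy nonnegative.
  have hK0 : 0 ≤ K := by
    have h1 : 0 ≤ PolyDG.mechEnergy c s0 m0 u0 w0 u1 w1 := by
      linarith [hcoer u0 w0 u1 w1, hkin u1, hmix (u1 + PolyDG.cmul (fun i => (c.phi i)⁻¹) w1),
        hdgE u0, hdgP (PolyDG.cmul c.beta u0 + w0)]
    have h2 := intervalIntegral.integral_nonneg (μ := volume) hT.le fun s _ =>
      PolyDG.wsq_nonneg (M := M) (fun i => (div_pos (c.k_pos i) (c.eta_pos i)).le) fun _ x => g s x
    have h3 := intervalIntegral.integral_nonneg (μ := volume) hT.le fun s _ =>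
      PolyDG.wsq_nonneg (M := M) (fun i => inv_nonneg.2 (hrhou i)) fun _ x => f s x
    have h4 := mul_nonneg hT.le h3
    linarith
  have hDc : ContinuousOn D (Icc 0 T) := PolyDG.continuousOn_wsq _ (hS.continuousOn_wt hT.le)
  have hDi : IntervalIntegrable D volume 0 T :=
    (hDc.mono (uIcc_of_le hT.le).subset).intervalIntegrable
  have hDnn : ∀ t ∈ Icc 0 T, 0 ≤ ∫ s in (0 : ℝ)..t, D s := fun t ht =>
    intervalIntegral.integral_nonneg ht.1 fun s _ => hdiss (wt s)
  have hQc : ContinuousOn Q (Icc 0 T) := by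
    obtain ⟨N', hN', hN, -⟩ := hS.mechEnergy_eq hd1 hT.le
    have h := intervalIntegral.continuousOn_primitive_interval' hDi left_mem_uIcc
    rw [uIcc_of_le hT.le] at h
    exact (PolyDG.continuousOn_primitive hT.le hN' hN).fun_add h
  -- The factor 2 before the ρ_u term in the coercivity bound becomes 1/2 here and lowers the
  -- Gronwall coefficient from 1/T to 1/(2T).
  have hRQ : ∀ t ∈ Icc 0 T, PolyDG.wsq M c.rhou (ut t).fn ≤ 1 / 2 * Q t := by
    intro t ht
    linarith [hcoer (u t) (w t) (ut t) (wt t), hDnn t ht,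
      hmix (ut t + PolyDG.cmul (fun i => (c.phi i)⁻¹) (wt t)), hdgE (u t),
      hdgP (PolyDG.cmul c.beta (u t) + w t)]
  have hgron : ∀ t ∈ Icc 0 T, Q t ≤ K + 1 / (2 * T) * ∫ s in (0 : ℝ)..t, Q s := by
    intro t ht
    have hsub : uIcc 0 t ⊆ Icc 0 T := by
      rw [uIcc_of_le ht.1]; exact Icc_subset_Icc_right ht.2
    have h := hS.mechEnergy_add_le hΩ hd1 hT hf hg ht
    have hR : ∫ s in (0 : ℝ)..t, PolyDG.wsq M c.rhou (ut s).fn ≤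
        ∫ s in (0 : ℝ)..t, 1 / 2 * Q s :=
      intervalIntegral.integral_mono_on ht.1
        ((PolyDG.continuousOn_wsq _ (hS.continuousOn_ut hT.le)).mono hsub).intervalIntegrable
        ((hQc.mono hsub).intervalIntegrable.const_mul _) fun s hs => hRQ s ⟨hs.1, hs.2.trans ht.2⟩
    rw [intervalIntegral.integral_const_mul] at hR
    have hR' := mul_le_mul_of_nonneg_left hR (one_div_pos.2 hT).le
    have hcoef : 1 / (2 * T) * ∫ s in (0 : ℝ)..t, Q s =
        1 / T * (1 / 2 * ∫ s in (0 : ℝ)..t, Q s) := by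
      field_simp
    rw [hcoef]
    linarith
  intro t ht
  -- Coercivity bounds 7/8 of the energy without its initial term ‖(η/k)^{1/2}w(0)‖² by Q ≤ (12/7)
  -- K, so that part is at most (96/49) K ≤ 2K; the initial term occurs on the right with factor 2.
  have hfin := PolyDG.le_of_le_add_integral hT hQc hK0 hgron t ht
  have hc := hcoer (u t) (w t) (ut t) (wt t)
  have hW0 := hdiss w0
  have hQt : Q t = PolyDG.mechEnergy c s0 m0 (u t) (w t) (ut t) (wt t) +
    ∫ s in (0 : ℝ)..t, D s := rfl
  have hinit : PolyDG.initialEnergy c s0 m0 u0 w0 u1 w1 =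
      PolyDG.mechEnergy c s0 m0 u0 w0 u1 w1 +
        PolyDG.wsq M (fun i => c.eta i / c.k i) w0.fn := by
    rw [PolyDG.initialEnergy, PolyDG.mechEnergy]; ring
  rw [PolyDG.energySq, hinit, hS.init_w]
  linarith [hDnn t ht, hkin (ut t), hmix (ut t + PolyDG.cmul (fun i => (c.phi i)⁻¹) (wt t))]
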